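/- **Theorem.** There is a universal constant $C>0$ with the following property. Let $a(n)\neq 0$ and $b(n)$ $(n\in\mathbb Z)$ be real numbers with $\sum_{n\ge 1}|a(n)|^{-1}=\sum_{n\ge1}|a(-n)|^{-1}=\infty$, and let $H$ be the (self-adjoint) operator on $\ell^2(\mathbb Z)$ given by $$(Hu)(n)=a(n)u(n+1)+a(n-1)u(n-1)+b(n)u(n)$$ on its maximal domain $\{u\in\ell^2(\mathbb Z): Hu\in\ell^2(\mathbb Z)\}$. Let $\mu$ be the spectral measure of $\delta_1$, i.e. $\langle (H-z)^{-1}\delta_1,\delta_1\rangle=\int_{\mathbb R}\frac{d\mu(x)}{x-z}$ for $z\in\mathbb C\setminus\mathbb R$, and write $\langle A(t)\rangle_T=\frac2T\int_0^\infty e^{-2t/T}A(t)\,dt$ and $$\|\phi\|_{L_1,L_2}^2=\sum_{n=-\lfloor L_1\rfloor}^{\lfloor L_2\rfloor}|\phi(n)|^2+(L_1-\lfloor L_1\rfloor)|\phi(-\lfloor L_1\rfloor-1)|^2+(L_2-\lfloor L_2\rfloor)|\phi(\lfloor L_2\rfloor+1)|^2 .$$ Then for all $T>0$ and $L_1,L_2>1$,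 $$\big\langle\|e^{-iHt}\delta_1\|_{L_1,L_2}^2\big\rangle_T> C\,\mu\big(\{E: L^-_{T^{-1}}(E)\le L_1\text{ and }L^+_{T^{-1}}(E)\le L_2\}\big),$$ and if $L_1,L_2>2$, then also $$\big\langle\|e^{-iHt}\delta_1\|_{L_1,L_2}^2\big\rangle_T> C\,\mu\big(\{E: \tilde L^-_{T^{-1}}(E)\le L_1\text{ and }\tilde L^+_{T^{-1}}(E)\le L_2\}\big).$$ Here the length scales are defined as follows. Let $\hat a(0)=1$ and $\hat a(n)=a(n)$ for $n\ne0$. For $E,\theta\in\mathbb R$ let $u_\theta(\cdot,E)$ be the solution on $\mathbb Z$ of $$\hat a(n)u(n+1)+\hat a(n-1)u(n-1)+b(n)u(n)=Eu(n),\qquad u_\theta(0,E)=\sin\theta,\quad u_\theta(1,E)=\cos\theta .$$ For $L\ge 0$ put $$\|\phi\|_{L,+}^2=\sum_{n=1}^{\lfloor L\rfloor}|\phi(n)|^2+(L-\lfloor L\rfloor)|\phi(\lfloor L\rfloor+1)|^2,\qquad \|\phi\|_{L,-}^2=\sum_{n=-\lfloor L\rfloor}^{0}|\phi(n)|^2+(L-\lfloor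 L\rfloor)|\phi(-\lfloor L\rfloor-1)|^2 .$$ For $\varepsilon>0$, $L^\pm_\varepsilon(E)$ is the unique $L\ge 0$ with $$\max_\theta\|u_\theta(\cdot,E)\|_{L,\pm}\cdot\min_\theta\|u_\theta(\cdot,E)\|_{L,\pm}=\varepsilon^{-1}.$$ Let $\Phi(n,E)=\begin{pmatrix}u_0(n+1,E)&u_{\pi/2}(n+1,E)\\u_0(n,E)&u_{\pi/2}(n,E)\end{pmatrix}$, let $\|\cdot\|$ be the Euclidean operator norm, and put $$\|\Phi(E)\|_{L,+}^2=\sum_{n=1}^{\lfloor L\rfloor-1}\|\Phi(n,E)\|^2+(L-\lfloor L\rfloor)\|\Phi(\lfloor L\rfloor,E)\|^2\quad(L\ge1),$$ $$\|\Phi(E)\|_{L,-}^2=\sum_{n=-\lfloor L\rfloor}^{-1}\|\Phi(n,E)\|^2+(L-\lfloor L\rfloor)\|\Phi(-\lfloor L\rfloor-1,E)\|^2\quad(L\ge0).$$ Then $\tilde L^+_\varepsilon(E)\ge 1$ and $\tilde L^-_\varepsilon(E)\ge 0$ are the unique numbers $L$ with, respectively, $$\|\Phi(E)\|_{L,+}=2\|\Phi(1,E)^{-1}\|\,\varepsilon^{-1},\qquad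 \|\Phi(E)\|_{L,-}=2\|\Phi(-1,E)^{-1}\|\,\varepsilon^{-1}.$$ -/

import Mathlib

open scoped lp

noncomputable section

namespace JacobiDyn

/-! ### The Jacobi operator on `ℓ²(ℤ)` -/

/-- The formal tridiagonal (Jacobi) expression
`(H u)(n) = a(n) u(n+1) + a(n-1) u(n-1) + b(n) u(n)`. -/
def jacobiExpr (a b : ℤ → ℝ) (u : ℤ → ℂ) (n : ℤ) : ℂ :=
  (a n : ℂ) * u (n + 1) + (a (n - 1) : ℂ) * u (n - 1) + (b n : ℂ) * u n

theorem jacobiExpr_add (a b : ℤ → ℝ) (u v : ℤ → ℂ) :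
    jacobiExpr a b (u + v) = jacobiExpr a b u + jacobiExpr a b v := by
  funext n; simp [jacobiExpr]; ring

theorem jacobiExpr_smul (a b : ℤ → ℝ) (c : ℂ) (u : ℤ → ℂ) :
    jacobiExpr a b (c • u) = c • jacobiExpr a b u := by
  funext n; simp [jacobiExpr]; ring

/-- The standing assumptions on the coefficients: `a(n) ≠ 0` for every `n`, and the series
`∑ |a(n)|⁻¹` diverges at `+∞` and at `-∞`. -/
structure IsJacobiData (a : ℤ → ℝ) : Prop where
  ne_zero : ∀ n, a n ≠ 0
  diverges_right : ¬ Summable fun n : ℕ => |a ((n : ℤ) + 1)|⁻¹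
  diverges_left : ¬ Summable fun n : ℕ => |a (-((n : ℤ) + 1))|⁻¹

/-- The maximal domain: all `u ∈ ℓ²(ℤ)` such that `H u ∈ ℓ²(ℤ)`. -/
def jacobiDomain (a b : ℤ → ℝ) : Submodule ℂ ℓ²(ℤ, ℂ) where
  carrier := {u | Memℓp (jacobiExpr a b u) 2}
  zero_mem' := by
    have h : jacobiExpr a b ((0 : ℓ²(ℤ, ℂ)) : ℤ → ℂ) = 0 := by
      funext n; simp [jacobiExpr]
    change Memℓp (jacobiExpr a b ((0 : ℓ²(ℤ, ℂ)) : ℤ → ℂ)) 2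
    rw [h]
    exact zero_memℓp
  add_mem' := by
    intro u v hu hv
    change Memℓp (jacobiExpr a b ((u + v : ℓ²(ℤ, ℂ)) : ℤ → ℂ)) 2
    rw [lp.coeFn_add, jacobiExpr_add]
    exact Memℓp.add hu hv
  smul_mem' := by
    intro c u hu
    change Memℓp (jacobiExpr a b ((c • u : ℓ²(ℤ, ℂ)) : ℤ → ℂ)) 2
    rw [lp.coeFn_smul, jacobiExpr_smul]
    exact Memℓp.const_smul hu c

/-- The (in general unbounded) Jacobi operator `H` on `ℓ²(ℤ)` with its maximal domain. Under
`IsJacobiData a` it is self-adjoint. -/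
def jacobiOperator (a b : ℤ → ℝ) : ℓ²(ℤ, ℂ) →ₗ.[ℂ] ℓ²(ℤ, ℂ) where
  domain := jacobiDomain a b
  toFun :=
    { toFun := fun u => ⟨jacobiExpr a b (u : ℓ²(ℤ, ℂ)), u.2⟩
      map_add' := fun _ _ => Subtype.ext (jacobiExpr_add a b _ _)
      map_smul' := fun c _ => Subtype.ext (jacobiExpr_smul a b c _) }

/-- The unit vector `δ₁`. -/
def delta1 : ℓ²(ℤ, ℂ) := lp.single 2 (1 : ℤ) (1 : ℂ)

/-- `ψ(t) = e^{-iHt} ψ₀` for `ψ₀` in the domain of the self-adjoint operator `H`: the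
(unique) solution of `i ∂ₜ ψ = H ψ`, `ψ(0) = ψ₀`, the derivative being taken in norm. -/
def IsEvolution (H : ℓ²(ℤ, ℂ) →ₗ.[ℂ] ℓ²(ℤ, ℂ)) (ψ₀ : ℓ²(ℤ, ℂ)) (ψ : ℝ → ℓ²(ℤ, ℂ)) : Prop :=
  ψ 0 = ψ₀ ∧ ∀ t : ℝ, ∃ v : H.domain, (v : ℓ²(ℤ, ℂ)) = ψ t ∧
    HasDerivAt ψ ((-Complex.I) • H v) t

/-- `μ` is the spectral measure of the vector `φ` for the self-adjoint operator `H`: the (unique)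
finite Borel measure on `ℝ` with `⟨(H - z)⁻¹ φ, φ⟩ = ∫ dμ(x) / (x - z)` for all non-real `z`.
Here `g = (H - z)⁻¹ φ` is the unique vector of the domain with `H g - z g = φ`; Mathlib's
inner product is conjugate-linear in its first argument. -/
def IsSpectralMeasure (H : ℓ²(ℤ, ℂ) →ₗ.[ℂ] ℓ²(ℤ, ℂ)) (φ : ℓ²(ℤ, ℂ))
    (μ : MeasureTheory.Measure ℝ) : Prop :=
  MeasureTheory.IsFiniteMeasure μ ∧ ∀ z : ℂ, z.im ≠ 0 →
    ∃ g : H.domain, H g - z • (g : ℓ²(ℤ, ℂ)) = φ ∧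
      inner ℂ φ (g : ℓ²(ℤ, ℂ)) = ∫ x : ℝ, ((x : ℂ) - z)⁻¹ ∂μ

/-- The time average `⟨A⟩_T = (2/T) ∫₀^∞ e^{-2t/T} A(t) dt`. -/
def timeAverage (T : ℝ) (A : ℝ → ℝ) : ℝ :=
  (2 / T) * ∫ t in Set.Ioi (0 : ℝ), Real.exp (-2 * t / T) * A t

/-! ### Truncated norms -/

/-- `‖φ‖²_{L₁,L₂}`: the weight of `φ` in `[-L₁, L₂]`, interpolated linearly in `L₁`, `L₂`. -/
def boxNormSq (φ : ℤ → ℂ) (L₁ L₂ : ℝ) : ℝ :=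
  ∑ n ∈ Finset.Icc (-⌊L₁⌋) ⌊L₂⌋, ‖φ n‖ ^ 2
    + (L₁ - ⌊L₁⌋) * ‖φ (-⌊L₁⌋ - 1)‖ ^ 2 + (L₂ - ⌊L₂⌋) * ‖φ (⌊L₂⌋ + 1)‖ ^ 2

/-- `‖φ‖²_L` on the right half-line `1, 2, 3, …`. -/
def rightNormSq (φ : ℤ → ℝ) (L : ℝ) : ℝ :=
  ∑ n ∈ Finset.Icc 1 ⌊L⌋, φ n ^ 2 + (L - ⌊L⌋) * φ (⌊L⌋ + 1) ^ 2

/-- `‖φ‖²_L` on the left half-line `0, -1, -2, …`: the sum runs from `-⌊L⌋` up to `0`. -/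
def leftNormSq (φ : ℤ → ℝ) (L : ℝ) : ℝ :=
  ∑ n ∈ Finset.Icc (-⌊L⌋) 0, φ n ^ 2 + (L - ⌊L⌋) * φ (-⌊L⌋ - 1) ^ 2

/-! ### Solutions of the eigenvalue equation and transfer matrices -/

/-- For `n ≥ 0` the pair `(u(n), u(n+1))`, for the solution with
`u(0) = sin θ`, `u(1) = cos θ`. -/
def rightPair (a b : ℤ → ℝ) (E θ : ℝ) : ℕ → ℝ × ℝ
  | 0 => (Real.sin θ, Real.cos θ)
  | n + 1 =>
    let p := rightPair a b E θ n
    (p.2, ((E - b (n + 1)) * p.2 - a n * p.1) / a (n + 1))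

/-- For `n ≥ 0` the pair `(u(-n), u(-n+1))`, for the solution with
`u(0) = sin θ`, `u(1) = cos θ`. -/
def leftPair (a b : ℤ → ℝ) (E θ : ℝ) : ℕ → ℝ × ℝ
  | 0 => (Real.sin θ, Real.cos θ)
  | n + 1 =>
    let p := leftPair a b E θ n
    (((E - b (-n)) * p.1 - a (-n) * p.2) / a (-n - 1), p.1)

/-- The solution `u_θ(·, E)` of `a(n) u(n+1) + a(n-1) u(n-1) + b(n) u(n) = E u(n)` on `ℤ`
with `u_θ(0) = sin θ`, `u_θ(1) = cos θ`. -/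
def sol (a b : ℤ → ℝ) (E θ : ℝ) : ℤ → ℝ
  | Int.ofNat n => (rightPair a b E θ n).1
  | Int.negSucc n => (leftPair a b E θ (n + 1)).1

theorem sol_zero (a b : ℤ → ℝ) (E θ : ℝ) : sol a b E θ 0 = Real.sin θ := rfl

theorem sol_one (a b : ℤ → ℝ) (E θ : ℝ) : sol a b E θ 1 = Real.cos θ := rfl

theorem sol_equation (a b : ℤ → ℝ) (ha : ∀ n, a n ≠ 0) (E θ : ℝ) (n : ℤ) :
    a n * sol a b E θ (n + 1) + a (n - 1) * sol a b E θ (n - 1) + b n * sol a b E θ n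
      = E * sol a b E θ n := by
  have key : ∀ k : ℕ, sol a b E θ (k : ℤ) = (rightPair a b E θ k).1 := fun k => rfl
  have key2 : ∀ k : ℕ, (rightPair a b E θ k).2 = sol a b E θ ((k : ℤ) + 1) := fun k => rfl
  have keyl : ∀ k : ℕ, sol a b E θ (-(k : ℤ)) = (leftPair a b E θ k).1 := by
    intro k
    cases k with
    | zero => rfl
    | succ k => rfl
  have keyl2 : ∀ k : ℕ, (leftPair a b E θ k).2 = sol a b E θ (-(k : ℤ) + 1) := by
    intro k
    cases k with
    | zero => rfl
    | succ k =>
      have h : (-((k + 1 : ℕ) : ℤ) + 1) = -(k : ℤ) := by push_cast; ring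
      rw [h, keyl]; rfl
  rcases lt_or_ge 0 n with h | h
  · obtain ⟨k, rfl⟩ : ∃ k : ℕ, n = k + 1 := ⟨(n - 1).toNat, by omega⟩
    have e : sol a b E θ ((k : ℤ) + 1 + 1)
        = ((E - b (k + 1)) * sol a b E θ ((k : ℤ) + 1) - a k * sol a b E θ k) / a (k + 1) := by
      rw [← key2, key]
      have : ((k : ℤ) + 1 + 1) = ((k + 2 : ℕ) : ℤ) := by push_cast; ring
      rw [this, key]
      rfl
    have hk := ha ((k : ℤ) + 1)
    rw [e, add_sub_cancel_right]
    field_simp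
    ring
  · obtain ⟨k, rfl⟩ : ∃ k : ℕ, n = -(k : ℤ) := ⟨(-n).toNat, by omega⟩
    have e : sol a b E θ (-(k : ℤ) - 1)
        = ((E - b (-k)) * sol a b E θ (-(k : ℤ)) - a (-k) * sol a b E θ (-(k : ℤ) + 1))
            / a (-k - 1) := by
      rw [← keyl2, keyl]
      have : (-(k : ℤ) - 1) = -((k + 1 : ℕ) : ℤ) := by push_cast; ring
      rw [this, keyl]
      simp only [leftPair]
      push_cast
      ring_nf
    have hk := ha (-(k : ℤ) - 1)
    rw [e]
    field_simp
    ring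

/-- The transfer matrix from site `0` to site `n`,
`Φ(n, E) = (u₀(n+1) u_{π/2}(n+1); u₀(n) u_{π/2}(n))`. -/
def transfer (a b : ℤ → ℝ) (E : ℝ) (n : ℤ) : Matrix (Fin 2) (Fin 2) ℝ :=
  !![sol a b E 0 (n + 1), sol a b E (Real.pi / 2) (n + 1);
     sol a b E 0 n, sol a b E (Real.pi / 2) n]

/-- The operator norm of a `2 × 2` matrix with respect to the Euclidean norm. -/
def opNorm (M : Matrix (Fin 2) (Fin 2) ℝ) : ℝ :=
  ‖Matrix.toEuclideanCLM (n := Fin 2) (𝕜 := ℝ) M‖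

/-- `‖Φ(E)‖²_L` on the right half-line; the matrices in it involve the sites `1, …, ⌊L⌋`, and
`⌊L⌋ + 1` in the last term. -/
def rightTransferSq (a b : ℤ → ℝ) (E L : ℝ) : ℝ :=
  ∑ n ∈ Finset.Icc 1 (⌊L⌋ - 1), opNorm (transfer a b E n) ^ 2
    + (L - ⌊L⌋) * opNorm (transfer a b E ⌊L⌋) ^ 2

/-- `‖Φ(E)‖²_L` on the left half-line; the matrices in it involve the sites `-⌊L⌋, …, 0`, and
`-⌊L⌋ - 1` in the last term. -/
def leftTransferSq (a b : ℤ → ℝ) (E L : ℝ) : ℝ :=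
  ∑ n ∈ Finset.Icc (-⌊L⌋) (-1), opNorm (transfer a b E n) ^ 2
    + (L - ⌊L⌋) * opNorm (transfer a b E (-⌊L⌋ - 1)) ^ 2

/-! ### Characteristic length scales

The scales belong to the two half-line operators on `{1, 2, …}` and `{0, -1, …}`. These do not
involve `a(0)`, which enters the solutions `u_θ` only as a normalization; it is set to `1`. -/

/-- The coefficients `a` with `a(0)` replaced by `1`. -/
def normalized (a : ℤ → ℝ) : ℤ → ℝ := Function.update a 0 1

/-- The scale `L⁺_ε(E)`: the `L` at which
`max_θ ‖u_θ‖_L · min_θ ‖u_θ‖_L = ε⁻¹` on the right half-line. Under `IsJacobiData a` and for `ε > 0`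
there is exactly one such `L`, since the left side vanishes for `L ≤ 1` and then increases strictly
and continuously to infinity. -/
def scaleRight (a b : ℤ → ℝ) (ε E : ℝ) : ℝ :=
  sInf {L : ℝ | 0 ≤ L ∧
    (⨆ θ : ℝ, √(rightNormSq (sol (normalized a) b E θ) L)) *
      (⨅ θ : ℝ, √(rightNormSq (sol (normalized a) b E θ) L)) = ε⁻¹}

/-- The scale `L⁻_ε(E)`: the analogue of `L⁺_ε(E)` on the left half-line. -/
def scaleLeft (a b : ℤ → ℝ) (ε E : ℝ) : ℝ :=
  sInf {L : ℝ | 0 ≤ L ∧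
    (⨆ θ : ℝ, √(leftNormSq (sol (normalized a) b E θ) L)) *
      (⨅ θ : ℝ, √(leftNormSq (sol (normalized a) b E θ) L)) = ε⁻¹}

/-- The transfer matrix scale on the right half-line: the (unique) `L ≥ 1` with
`‖Φ(E)‖_L = 2 ‖Φ(1,E)⁻¹‖ ε⁻¹`. -/
def transferScaleRight (a b : ℤ → ℝ) (ε E : ℝ) : ℝ :=
  sInf {L : ℝ | 1 ≤ L ∧
    √(rightTransferSq (normalized a) b E L)
      = 2 * opNorm (transfer (normalized a) b E 1)⁻¹ * ε⁻¹}

/-- The transfer matrix scale on the left half-line: the (unique) `L ≥ 0` with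
`‖Φ(E)‖_L = 2 ‖Φ(-1,E)⁻¹‖ ε⁻¹`. -/
def transferScaleLeft (a b : ℤ → ℝ) (ε E : ℝ) : ℝ :=
  sInf {L : ℝ | 0 ≤ L ∧
    √(leftTransferSq (normalized a) b E L)
      = 2 * opNorm (transfer (normalized a) b E (-1))⁻¹ * ε⁻¹}

end JacobiDyn

end

/-!
Put `ε = T⁻¹`. By Plancherel the time average of the squared norm of `e^{-iHt} δ₁` on a box is, up
to the factor `(π T)⁻¹`, the integral over `E` of the squared norm on the box of
`u = (H - E - iε)⁻¹ δ₁`. On each half-line `u` is a combination of real solutions at an energy `E'`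
within `ε` of `E`, plus a variation of constants term proportional to `ε` (Jitomirskaya–Last): where
the largest and the smallest norm of the solutions `u_θ` have product at least `ε⁻¹`, the boundary
term `Im (conj u(0) u(1))` is at most a constant times `ε ‖u‖²`. The boundary terms of the two
half-lines add up to `-Im u(1)`, and `Im u(1)` is the imaginary part of the Borel transform of `μ`,
at least `(2 ε)⁻¹ μ (E - ε, E + ε)`. Integrating over the `ε`-neighbourhood of the set of admissible
`E'` and exchanging the order of integration bounds the time average below by the measure of
this set.
-/

noncomputable section

namespace JacobiDyn

open Finset

/-! ### Interpolated sums over a half-line -/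

section PartialSum

/-- The weight of the site `k + 1` in a sum of length `s` over the sites `1, 2, 3, …`; it increases
linearly from `0` to `1` as `s` runs through `[k, k + 1]`. -/
def cutoff (s : ℝ) (k : ℕ) : ℝ := max 0 (min 1 (s - k))

/-- The sum of length `s` over the sites `1, 2, 3, …`, interpolated linearly in `s`. Applied to
`φ ^ 2` it is the square of the truncated norm of `φ`. -/
def partialSum (s : ℝ) : (ℕ → ℝ) →ₗ[ℝ] ℝ :=
  ∑ k ∈ range ⌈s⌉₊, cutoff s k • LinearMap.proj (k + 1)

variable {s t : ℝ} {c d : ℕ → ℝ} {k n : ℕ}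

theorem partialSum_apply (s : ℝ) (c : ℕ → ℝ) :
    partialSum s c = ∑ k ∈ range ⌈s⌉₊, cutoff s k * c (k + 1) := by
  simp [partialSum]

theorem cutoff_nonneg (s : ℝ) (k : ℕ) : 0 ≤ cutoff s k := le_max_left _ _

theorem cutoff_mono (h : s ≤ t) (k : ℕ) : cutoff s k ≤ cutoff t k := by
  unfold cutoff; gcongr

theorem cutoff_eq_zero (h : s ≤ k) : cutoff s k = 0 :=
  max_eq_left ((min_le_right _ _).trans (sub_nonpos.2 h))

theorem cutoff_eq_one (h : (k : ℝ) + 1 ≤ s) : cutoff s k = 1 := by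
  rw [cutoff, min_eq_left (by linarith), max_eq_right zero_le_one]

theorem cutoff_floor (hs : 0 ≤ s) : cutoff s ⌊s⌋₊ = s - ⌊s⌋₊ := by
  have h1 := Nat.floor_le hs
  have h2 := Nat.lt_floor_add_one s
  rw [cutoff, min_eq_right (by linarith), max_eq_right (by linarith)]

theorem lt_of_cutoff_ne_zero (h : cutoff s k ≠ 0) : (k : ℝ) < s :=
  lt_of_not_ge fun h' => h (cutoff_eq_zero h')

theorem partialSum_eq_sum_range (h : s ≤ n) (c : ℕ → ℝ) :
    partialSum s c = ∑ k ∈ range n, cutoff s k * c (k + 1) := by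
  rw [partialSum_apply]
  refine sum_subset (range_subset_range.2 (Nat.ceil_le.2 h)) fun k _ hk => ?_
  rw [mem_range, not_lt, Nat.ceil_le] at hk
  rw [cutoff_eq_zero hk, zero_mul]

theorem partialSum_eq_floor (hs : 0 ≤ s) (c : ℕ → ℝ) :
    partialSum s c = ∑ k ∈ range ⌊s⌋₊, c (k + 1) + (s - ⌊s⌋₊) * c (⌊s⌋₊ + 1) := by
  rw [partialSum_eq_sum_range (n := ⌊s⌋₊ + 1) (mod_cast (Nat.lt_floor_add_one s).le),
    sum_range_succ, cutoff_floor hs]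
  congr 1
  refine sum_congr rfl fun k hk => ?_
  have hks : ((k + 1 : ℕ) : ℝ) ≤ ⌊s⌋₊ := mod_cast mem_range.1 hk
  rw [cutoff_eq_one (mod_cast hks.trans (Nat.floor_le hs)), one_mul]

theorem partialSum_natCast (n : ℕ) (c : ℕ → ℝ) :
    partialSum n c = ∑ k ∈ range n, c (k + 1) := by
  simp [partialSum_eq_floor]

theorem partialSum_eq_zero_of_nonpos (hs : s ≤ 0) (c : ℕ → ℝ) : partialSum s c = 0 := by
  rw [partialSum_apply, Nat.ceil_eq_zero.2 hs, sum_range_zero]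

theorem partialSum_le_partialSum (h : ∀ k : ℕ, (k : ℝ) < s → c (k + 1) ≤ d (k + 1)) :
    partialSum s c ≤ partialSum s d := by
  rw [partialSum_apply, partialSum_apply]
  refine sum_le_sum fun k _ => ?_
  by_cases hk : cutoff s k = 0
  · simp [hk]
  · exact mul_le_mul_of_nonneg_left (h k (lt_of_cutoff_ne_zero hk)) (cutoff_nonneg s k)

theorem partialSum_nonneg (s : ℝ) (h : 0 ≤ c) : 0 ≤ partialSum s c := by
  rw [partialSum_apply]
  exact sum_nonneg fun k _ => mul_nonneg (cutoff_nonneg s k) (h _)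

theorem partialSum_sq_nonneg (s : ℝ) (c : ℕ → ℝ) : 0 ≤ partialSum s (c ^ 2) :=
  partialSum_nonneg s fun k => sq_nonneg (c k)

theorem partialSum_mono_left (hst : s ≤ t) (h : 0 ≤ c) : partialSum s c ≤ partialSum t c := by
  rw [partialSum_eq_sum_range (hst.trans (Nat.le_ceil t)), partialSum_apply]
  exact sum_le_sum fun k _ => mul_le_mul_of_nonneg_right (cutoff_mono hst k) (h _)

theorem sum_range_le_partialSum (hn : (n : ℝ) ≤ s) (h : 0 ≤ c) :
    ∑ k ∈ range n, c (k + 1) ≤ partialSum s c :=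
  (partialSum_natCast n c).symm.le.trans (partialSum_mono_left hn h)

theorem continuous_partialSum (c : ℕ → ℝ) : Continuous fun s => partialSum s c := by
  refine continuous_iff_continuousAt.2 fun s => ?_
  obtain ⟨n, hn⟩ := exists_nat_gt s
  have hc : Continuous fun t => ∑ k ∈ range n, cutoff t k * c (k + 1) := by
    unfold cutoff; fun_prop
  refine hc.continuousAt.congr ?_
  filter_upwards [Iio_mem_nhds hn] with t ht
  exact (partialSum_eq_sum_range (le_of_lt ht) c).symm

theorem partialSum_add_one (hs : 0 ≤ s) (c : ℕ → ℝ) :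
    partialSum (s + 1) c = c 1 + partialSum s fun k => c (k + 1) := by
  rw [partialSum_eq_floor hs, partialSum_eq_floor (by linarith), Nat.floor_add_one hs,
    sum_range_succ']
  push_cast
  ring

end PartialSum

/-! ### Solutions on a half-line -/

section Solution

variable {K : Type*} [CommRing K]

/-- `W` solves the three-term recurrence with coefficients `A`, `B` and spectral parameter `z`
at the sites `1, 2, 3, …`. -/
def IsSolution (A B : ℕ → K) (z : K) (W : ℕ → K) : Prop :=
  ∀ n, A (n + 1) * W (n + 2) + A n * W n + B (n + 1) * W (n + 1) = z * W (n + 1)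

/-- The Wronskian `A(n) (f(n+1) g(n) - f(n) g(n+1))`. -/
def wronskian (A f g : ℕ → K) (n : ℕ) : K :=
  A n * (f (n + 1) * g n - f n * g (n + 1))

/-- `f` and `g` solve the three-term recurrence at the sites `1, 2, 3, …`, and their Wronskian,
which is then constant, is equal to `1`. -/
structure IsFundamentalPair (A B : ℕ → K) (z : K) (f g : ℕ → K) : Prop where
  left : IsSolution A B z f
  right : IsSolution A B z g
  wronskian_zero : wronskian A f g 0 = 1

variable {A B f g W : ℕ → K} {z w : K}

theorem IsSolution.wronskian_eq (hf : IsSolution A B z f) (hg : IsSolution A B w g) (n : ℕ) :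
    wronskian A f g n
      = wronskian A f g 0 + (z - w) * ∑ k ∈ range n, f (k + 1) * g (k + 1) := by
  induction n with
  | zero => simp
  | succ n ih =>
    have step : wronskian A f g (n + 1)
        = wronskian A f g n + (z - w) * (f (n + 1) * g (n + 1)) := by
      simp only [wronskian]
      linear_combination g (n + 1) * hf n - f (n + 1) * hg n
    rw [step, ih, sum_range_succ]
    ring

theorem IsSolution.smul_add_smul (hf : IsSolution A B z f) (hg : IsSolution A B z g) (x y : K) :
    IsSolution A B z (x • f + y • g) := fun n => by
  simp only [Pi.add_apply, Pi.smul_apply, smul_eq_mul]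
  linear_combination x * hf n + y * hg n

theorem IsFundamentalPair.wronskian_eq_one (h : IsFundamentalPair A B z f g) (n : ℕ) :
    wronskian A f g n = 1 := by
  rw [h.left.wronskian_eq h.right, h.wronskian_zero, sub_self, zero_mul, add_zero]

theorem IsFundamentalPair.map {L : Type*} [CommRing L] (h : IsFundamentalPair A B z f g)
    (φ : K →+* L) : IsFundamentalPair (φ ∘ A) (φ ∘ B) (φ z) (φ ∘ f) (φ ∘ g) where
  left n := by simpa using congrArg φ (h.left n)
  right n := by simpa using congrArg φ (h.right n)
  wronskian_zero := by simpa [wronskian] using congrArg φ h.wronskian_zero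

theorem IsFundamentalPair.variation_of_constants (h : IsFundamentalPair A B w f g)
    (hW : IsSolution A B z W) (n : ℕ) :
    W (n + 1) = wronskian A W g 0 * f (n + 1) + wronskian A f W 0 * g (n + 1)
      + (z - w) * ((∑ k ∈ range n, W (k + 1) * g (k + 1)) * f (n + 1)
        - (∑ k ∈ range n, f (k + 1) * W (k + 1)) * g (n + 1)) := by
  have hWg := hW.wronskian_eq h.right n
  have hfW := h.left.wronskian_eq hW n
  have hfg := h.wronskian_eq_one n
  rw [wronskian] at hWg hfW hfg
  linear_combination f (n + 1) * hWg + g (n + 1) * hfW - W (n + 1) * hfg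

end Solution

/-! ### Rotations and Gram determinants -/

section Gram

/-- The combination of `f` and `g` at angle `θ`; the combination orthogonal to it is
`rotated f g (θ + π / 2)`. -/
def rotated (f g : ℕ → ℝ) (θ : ℝ) : ℕ → ℝ := Real.cos θ • f + Real.sin θ • g

/-- The Gram determinant of `f` and `g` for the truncated inner product of length `s`. -/
def gram (f g : ℕ → ℝ) (s : ℝ) : ℝ :=
  partialSum s (f ^ 2) * partialSum s (g ^ 2) - partialSum s (f * g) ^ 2

variable {f g : ℕ → ℝ}

theorem continuous_gram (f g : ℕ → ℝ) : Continuous (gram f g) := by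
  have := continuous_partialSum (f ^ 2)
  have := continuous_partialSum (g ^ 2)
  have := continuous_partialSum (f * g)
  unfold gram
  fun_prop

theorem gram_eq_zero_of_le_one {s : ℝ} (hs : s ≤ 1) : gram f g s = 0 := by
  have h := partialSum_eq_sum_range (n := 1) (by exact_mod_cast hs)
  simp only [gram, h, sum_range_one, Pi.pow_apply, Pi.mul_apply]
  ring

theorem two_mul_gram_eq (f g : ℕ → ℝ) (s : ℝ) :
    2 * gram f g s = partialSum s fun j => partialSum s fun k => (f j * g k - g j * f k) ^ 2 := by
  have inner (j : ℕ) : (partialSum s fun k => (f j * g k - g j * f k) ^ 2)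
      = f j ^ 2 * partialSum s (g ^ 2) - 2 * (f j * g j) * partialSum s (f * g)
        + g j ^ 2 * partialSum s (f ^ 2) := by
    rw [← smul_eq_mul, ← smul_eq_mul, ← smul_eq_mul (g j ^ 2), ← map_smul, ← map_smul, ← map_smul,
      ← map_sub, ← map_add]
    congr 1
    ext k
    simp only [Pi.add_apply, Pi.sub_apply, Pi.smul_apply, Pi.pow_apply, Pi.mul_apply, smul_eq_mul]
    ring
  have outer : (fun j => partialSum s fun k => (f j * g k - g j * f k) ^ 2)
      = partialSum s (g ^ 2) • f ^ 2 - (2 * partialSum s (f * g)) • (f * g)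
        + partialSum s (f ^ 2) • g ^ 2 := by
    ext j
    rw [inner]
    simp only [Pi.add_apply, Pi.sub_apply, Pi.smul_apply, Pi.pow_apply, Pi.mul_apply, smul_eq_mul]
    ring
  rw [outer, map_add, map_sub, map_smul, map_smul, map_smul, gram]
  simp only [smul_eq_mul]
  ring

theorem gram_monotone (f g : ℕ → ℝ) : Monotone (gram f g) := fun s t hst => by
  have inner (r : ℝ) (j : ℕ) : 0 ≤ partialSum r fun k => (f j * g k - g j * f k) ^ 2 :=
    partialSum_nonneg r fun k => sq_nonneg _
  have key : 2 * gram f g s ≤ 2 * gram f g t := by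
    rw [two_mul_gram_eq, two_mul_gram_eq]
    exact (partialSum_le_partialSum fun j _ =>
      partialSum_mono_left hst fun k => sq_nonneg _).trans (partialSum_mono_left hst (inner t))
  linarith

theorem gram_nonneg (f g : ℕ → ℝ) (s : ℝ) : 0 ≤ gram f g s := by
  rw [← gram_eq_zero_of_le_one (f := f) (g := g) (min_le_right s 1)]
  exact gram_monotone f g (min_le_left s 1)

theorem rotated_add_pi_div_two (f g : ℕ → ℝ) (θ : ℝ) :
    rotated f g (θ + Real.pi / 2) = -Real.sin θ • f + Real.cos θ • g := by
  rw [rotated, Real.cos_add_pi_div_two, Real.sin_add_pi_div_two]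

theorem partialSum_rotated_sq (f g : ℕ → ℝ) (s θ : ℝ) :
    partialSum s (rotated f g θ ^ 2) = Real.cos θ ^ 2 * partialSum s (f ^ 2)
      + 2 * Real.cos θ * Real.sin θ * partialSum s (f * g)
      + Real.sin θ ^ 2 * partialSum s (g ^ 2) := by
  have : rotated f g θ ^ 2 = Real.cos θ ^ 2 • f ^ 2 + (2 * Real.cos θ * Real.sin θ) • (f * g)
      + Real.sin θ ^ 2 • g ^ 2 := by
    rw [rotated]
    ext k
    simp only [Pi.add_apply, Pi.smul_apply, Pi.pow_apply, Pi.mul_apply, smul_eq_mul]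
    ring
  simp only [this, map_add, map_smul, smul_eq_mul]

theorem partialSum_rotated_mul (f g : ℕ → ℝ) (s θ : ℝ) :
    partialSum s (rotated f g θ * rotated f g (θ + Real.pi / 2))
      = Real.cos θ * Real.sin θ * (partialSum s (g ^ 2) - partialSum s (f ^ 2))
        + (Real.cos θ ^ 2 - Real.sin θ ^ 2) * partialSum s (f * g) := by
  have : rotated f g θ * rotated f g (θ + Real.pi / 2)
      = (Real.cos θ * Real.sin θ) • (g ^ 2 - f ^ 2)
        + (Real.cos θ ^ 2 - Real.sin θ ^ 2) • (f * g) := by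
    rw [rotated_add_pi_div_two, rotated]
    ext k
    simp only [Pi.add_apply, Pi.sub_apply, Pi.smul_apply, Pi.pow_apply, Pi.mul_apply, smul_eq_mul]
    ring
  simp only [this, map_add, map_sub, map_smul, smul_eq_mul]

theorem partialSum_rotated_sq_add (f g : ℕ → ℝ) (s θ : ℝ) :
    partialSum s (rotated f g θ ^ 2) + partialSum s (rotated f g (θ + Real.pi / 2) ^ 2)
      = partialSum s (f ^ 2) + partialSum s (g ^ 2) := by
  rw [partialSum_rotated_sq, partialSum_rotated_sq, Real.cos_add_pi_div_two,
    Real.sin_add_pi_div_two]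
  linear_combination (partialSum s (f ^ 2) + partialSum s (g ^ 2)) * Real.cos_sq_add_sin_sq θ

theorem gram_rotated (f g : ℕ → ℝ) (s θ : ℝ) :
    gram (rotated f g θ) (rotated f g (θ + Real.pi / 2)) s = gram f g s := by
  rw [gram, partialSum_rotated_mul, partialSum_rotated_sq, partialSum_rotated_sq,
    Real.cos_add_pi_div_two, Real.sin_add_pi_div_two, gram]
  linear_combination (Real.cos θ ^ 2 + Real.sin θ ^ 2 + 1)
    * (partialSum s (f ^ 2) * partialSum s (g ^ 2) - partialSum s (f * g) ^ 2)
    * Real.cos_sq_add_sin_sq θ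

theorem hasDerivAt_partialSum_rotated_sq (f g : ℕ → ℝ) (s θ : ℝ) :
    HasDerivAt (fun θ => partialSum s (rotated f g θ ^ 2))
      (2 * partialSum s (rotated f g θ * rotated f g (θ + Real.pi / 2))) θ := by
  simp only [partialSum_rotated_sq]
  have hc := Real.hasDerivAt_cos θ
  have hs := Real.hasDerivAt_sin θ
  refine ((((hc.pow 2).mul_const (partialSum s (f ^ 2))).add
    (((hc.const_mul 2).mul hs).mul_const (partialSum s (f * g)))).add
    ((hs.pow 2).mul_const (partialSum s (g ^ 2)))).congr_deriv ?_
  rw [partialSum_rotated_mul]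
  push_cast
  ring

theorem exists_isMin_rotated (f g : ℕ → ℝ) (s : ℝ) :
    ∃ t, partialSum s (rotated f g t * rotated f g (t + Real.pi / 2)) = 0 ∧
      ∀ θ, partialSum s (rotated f g t ^ 2) ≤ partialSum s (rotated f g θ ^ 2) := by
  have hderiv := hasDerivAt_partialSum_rotated_sq f g s
  have hcont : Continuous fun θ => partialSum s (rotated f g θ ^ 2) :=
    continuous_iff_continuousAt.2 fun θ => (hderiv θ).continuousAt
  have hper : Function.Periodic (fun θ => partialSum s (rotated f g θ ^ 2)) (2 * Real.pi) :=
    fun θ => by simp only [rotated, Real.cos_add_two_pi, Real.sin_add_two_pi]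
  obtain ⟨-, ⟨t, rfl⟩, ht⟩ := (hper.compact_of_continuous Real.two_pi_pos.ne' hcont).exists_isLeast
    (Set.range_nonempty _)
  have hmin θ : partialSum s (rotated f g t ^ 2) ≤ partialSum s (rotated f g θ ^ 2) :=
    ht (Set.mem_range_self θ)
  have hzero := IsLocalMin.hasDerivAt_eq_zero (Filter.Eventually.of_forall hmin) (hderiv t)
  exact ⟨t, by linarith, hmin⟩

theorem iSup_sqrt_mul_iInf_sqrt_rotated (f g : ℕ → ℝ) (s : ℝ) :
    (⨆ θ : ℝ, √(partialSum s (rotated f g θ ^ 2)))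
      * (⨅ θ : ℝ, √(partialSum s (rotated f g θ ^ 2))) = √(gram f g s) := by
  obtain ⟨t, horth, hmin⟩ := exists_isMin_rotated f g s
  have hmax θ : √(partialSum s (rotated f g θ ^ 2))
      ≤ √(partialSum s (rotated f g (t + Real.pi / 2) ^ 2)) := by
    refine Real.sqrt_le_sqrt ?_
    have h1 := partialSum_rotated_sq_add f g s θ
    have h2 := partialSum_rotated_sq_add f g s t
    linarith [hmin (θ + Real.pi / 2)]
  have hsup : (⨆ θ : ℝ, √(partialSum s (rotated f g θ ^ 2)))
      = √(partialSum s (rotated f g (t + Real.pi / 2) ^ 2)) :=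
    IsGreatest.csSup_eq ⟨Set.mem_range_self _, Set.forall_mem_range.2 hmax⟩
  have hinf : (⨅ θ : ℝ, √(partialSum s (rotated f g θ ^ 2)))
      = √(partialSum s (rotated f g t ^ 2)) :=
    IsLeast.csInf_eq
      ⟨Set.mem_range_self _, Set.forall_mem_range.2 fun θ => Real.sqrt_le_sqrt (hmin θ)⟩
  rw [hsup, hinf, ← Real.sqrt_mul (partialSum_sq_nonneg s _), ← gram_rotated f g s t, gram, horth,
    mul_comm, zero_pow two_ne_zero, sub_zero]

end Gram

section HalfLineBounds

variable {A B f g : ℕ → ℝ} {E s : ℝ}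

theorem IsFundamentalPair.rotated (h : IsFundamentalPair A B E f g) (θ : ℝ) :
    IsFundamentalPair A B E (rotated f g θ) (rotated f g (θ + Real.pi / 2)) where
  left := h.left.smul_add_smul h.right _ _
  right := h.left.smul_add_smul h.right _ _
  wronskian_zero := by
    have h0 := h.wronskian_zero
    rw [rotated_add_pi_div_two]
    simp only [JacobiDyn.rotated, wronskian, Pi.add_apply, Pi.smul_apply, smul_eq_mul] at h0 ⊢
    linear_combination (Real.cos θ ^ 2 + Real.sin θ ^ 2) * h0 + Real.cos_sq_add_sin_sq θ

theorem IsFundamentalPair.abs_inv_eq (h : IsFundamentalPair A B E f g) (n : ℕ) :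
    |A n|⁻¹ = |f (n + 1) * g n - f n * g (n + 1)| := by
  rw [← abs_inv, eq_inv_of_mul_eq_one_right (h.wronskian_eq_one n)]

theorem sum_abs_mul_sub_mul_le (u v : ℕ → ℝ) (n : ℕ) :
    ∑ k ∈ range n, |u (k + 2) * v (k + 1) - u (k + 1) * v (k + 2)|
      ≤ 2 * (√(partialSum (n + 1) (u ^ 2)) * √(partialSum (n + 1) (v ^ 2))) := by
  have hsum (x : ℕ → ℝ) : partialSum (n + 1) (x ^ 2) = ∑ k ∈ range (n + 1), x (k + 1) ^ 2 := by
    rw [← Nat.cast_succ, partialSum_natCast]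
    rfl
  have head (x : ℕ → ℝ) : ∑ k ∈ range n, |x (k + 1)| ^ 2 ≤ partialSum (n + 1) (x ^ 2) := by
    simp only [hsum, sum_range_succ, sq_abs]
    exact le_add_of_nonneg_right (sq_nonneg _)
  have tail (x : ℕ → ℝ) : ∑ k ∈ range n, |x (k + 2)| ^ 2 ≤ partialSum (n + 1) (x ^ 2) := by
    simp only [hsum, sum_range_succ', sq_abs]
    exact le_add_of_nonneg_right (sq_nonneg _)
  have cauchy_schwarz := Real.sum_mul_le_sqrt_mul_sqrt (range n)
  calc ∑ k ∈ range n, |u (k + 2) * v (k + 1) - u (k + 1) * v (k + 2)|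
      ≤ ∑ k ∈ range n, |u (k + 2)| * |v (k + 1)| + ∑ k ∈ range n, |u (k + 1)| * |v (k + 2)| := by
        rw [← sum_add_distrib]
        exact sum_le_sum fun k _ => (abs_sub _ _).trans (by rw [abs_mul, abs_mul])
    _ ≤ √(partialSum (n + 1) (u ^ 2)) * √(partialSum (n + 1) (v ^ 2))
          + √(partialSum (n + 1) (u ^ 2)) * √(partialSum (n + 1) (v ^ 2)) := by
        refine add_le_add ((cauchy_schwarz _ _).trans ?_) ((cauchy_schwarz _ _).trans ?_)
        · gcongr
          exacts [tail u, head v]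
        · gcongr
          exacts [head u, tail v]
    _ = _ := (two_mul _).symm

theorem IsFundamentalPair.sum_abs_inv_le (h : IsFundamentalPair A B E f g) (n : ℕ) :
    ∑ k ∈ range n, |A (k + 1)|⁻¹ ≤ 2 * √(gram f g (n + 1)) := by
  obtain ⟨t, horth, -⟩ := exists_isMin_rotated f g (n + 1)
  simp only [(h.rotated t).abs_inv_eq]
  refine (sum_abs_mul_sub_mul_le _ _ n).trans_eq ?_
  rw [← Real.sqrt_mul (partialSum_sq_nonneg _ _), ← gram_rotated f g _ t, gram, horth,
    zero_pow two_ne_zero, sub_zero]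

theorem IsFundamentalPair.exists_lt_sqrt_gram (h : IsFundamentalPair A B E f g)
    (hA : ¬ Summable fun n => |A (n + 1)|⁻¹) (y : ℝ) : ∃ s, y < √(gram f g s) := by
  by_contra! hle
  exact hA (summable_of_sum_range_le (c := 2 * y) (fun n => by positivity) fun n =>
    (h.sum_abs_inv_le n).trans (by gcongr; exact hle _))

theorem exists_sqrt_gram_eq {f g : ℕ → ℝ} {s y : ℝ} (hy : 0 ≤ y) (hs : y ≤ √(gram f g s)) :
    ∃ t ≤ s, √(gram f g t) = y := by
  have h1 : √(gram f g (min s 1)) ≤ y := by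
    rwa [gram_eq_zero_of_le_one (min_le_right _ _), Real.sqrt_zero]
  obtain ⟨t, ht, hty⟩ := intermediate_value_Icc (min_le_left s 1)
    (continuous_gram f g).sqrt.continuousOn ⟨h1, hs⟩
  exact ⟨t, ht.2, hty⟩

variable {z : ℂ} {W : ℕ → ℂ}

theorem norm_sq_sum_mul_le_partialSum (W : ℕ → ℂ) (f : ℕ → ℝ) {n : ℕ} (hn : n < s) :
    ‖∑ k ∈ range n, W (k + 1) * f (k + 1)‖ ^ 2
      ≤ partialSum s (fun k => ‖W k‖ ^ 2) * partialSum s (f ^ 2) := by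
  have htri : ‖∑ k ∈ range n, W (k + 1) * f (k + 1)‖
      ≤ ∑ k ∈ range n, ‖W (k + 1)‖ * |f (k + 1)| :=
    (norm_sum_le _ _).trans_eq (by simp)
  calc ‖∑ k ∈ range n, W (k + 1) * f (k + 1)‖ ^ 2
      ≤ (∑ k ∈ range n, ‖W (k + 1)‖ * |f (k + 1)|) ^ 2 := by gcongr
    _ ≤ (∑ k ∈ range n, ‖W (k + 1)‖ ^ 2) * ∑ k ∈ range n, |f (k + 1)| ^ 2 :=
        sum_mul_sq_le_sq_mul_sq _ _ _
    _ ≤ _ := by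
        simp only [sq_abs]
        exact mul_le_mul (sum_range_le_partialSum hn.le fun k => sq_nonneg ‖W k‖)
          (sum_range_le_partialSum hn.le fun k => sq_nonneg (f k)) (by positivity)
          (partialSum_nonneg s fun k => sq_nonneg ‖W k‖)

theorem norm_add_sub_sq_le (x y v : ℂ) :
    ‖x + (y - v)‖ ^ 2 ≤ 3 * (‖x‖ ^ 2 + ‖y‖ ^ 2 + ‖v‖ ^ 2) := by
  have h : ‖x + (y - v)‖ ≤ ‖x‖ + (‖y‖ + ‖v‖) :=
    (norm_add_le _ _).trans (by gcongr; exact norm_sub_le _ _)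
  calc ‖x + (y - v)‖ ^ 2 ≤ (‖x‖ + (‖y‖ + ‖v‖)) ^ 2 := by gcongr
    _ ≤ _ := by nlinarith [sq_nonneg (‖x‖ - ‖y‖), sq_nonneg (‖x‖ - ‖v‖), sq_nonneg (‖y‖ - ‖v‖)]

theorem partialSum_norm_sq_of_orthogonal (horth : partialSum s (f * g) = 0) (α β : ℂ) :
    partialSum s (fun k => ‖α * f k + β * g k‖ ^ 2)
      = ‖α‖ ^ 2 * partialSum s (f ^ 2) + ‖β‖ ^ 2 * partialSum s (g ^ 2) := by
  have hexp : (fun k => ‖α * f k + β * g k‖ ^ 2)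
      = ‖α‖ ^ 2 • f ^ 2 + (2 * (α.re * β.re + α.im * β.im)) • (f * g) + ‖β‖ ^ 2 • g ^ 2 := by
    ext k
    simp only [← Complex.normSq_eq_norm_sq, Complex.normSq_apply, Complex.add_re, Complex.add_im,
      Complex.mul_re, Complex.mul_im, Complex.ofReal_re, Complex.ofReal_im, Pi.add_apply,
      Pi.smul_apply, Pi.pow_apply, Pi.mul_apply, smul_eq_mul]
    ring
  simp only [hexp, map_add, map_smul, horth, smul_eq_mul, mul_zero, add_zero]

theorem IsFundamentalPair.norm_sq_le (h : IsFundamentalPair A B E f g)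
    (hW : IsSolution (fun n => (A n : ℂ)) (fun n => (B n : ℂ)) z W) {n : ℕ} (hn : n < s) :
    ‖wronskian (fun n => (A n : ℂ)) W (fun n => g n) 0 * f (n + 1)
        + wronskian (fun n => (A n : ℂ)) (fun n => f n) W 0 * g (n + 1)‖ ^ 2
      ≤ 3 * (‖W (n + 1)‖ ^ 2 + ‖z - E‖ ^ 2 * partialSum s (fun k => ‖W k‖ ^ 2)
        * (partialSum s (g ^ 2) * f (n + 1) ^ 2 + partialSum s (f ^ 2) * g (n + 1) ^ 2)) := by
  have hvar := (h.map Complex.ofRealHom).variation_of_constants hW n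
  simp only [Function.comp_def, Complex.ofRealHom_eq_coe, mul_comm _ (W _)] at hvar
  have hbound (x y : ℕ → ℝ) : ‖(z - E) * ((∑ k ∈ range n, W (k + 1) * x (k + 1)) * y (n + 1))‖ ^ 2
      ≤ ‖z - E‖ ^ 2 * (partialSum s (fun k => ‖W k‖ ^ 2) * partialSum s (x ^ 2)
        * y (n + 1) ^ 2) := by
    rw [norm_mul, norm_mul, mul_pow, mul_pow, Complex.norm_real, Real.norm_eq_abs, sq_abs]
    gcongr
    exact norm_sq_sum_mul_le_partialSum W x hn
  have hsplit : wronskian (fun n => (A n : ℂ)) W (fun n => g n) 0 * f (n + 1)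
        + wronskian (fun n => (A n : ℂ)) (fun n => f n) W 0 * g (n + 1)
      = W (n + 1) + ((z - E) * ((∑ k ∈ range n, W (k + 1) * f (k + 1)) * g (n + 1))
        - (z - E) * ((∑ k ∈ range n, W (k + 1) * g (k + 1)) * f (n + 1))) := by
    linear_combination -hvar
  rw [hsplit]
  refine (norm_add_sub_sq_le _ _ _).trans ?_
  linarith [hbound f g, hbound g f]

theorem IsFundamentalPair.norm_sq_add_norm_sq_le_of_orthogonal (h : IsFundamentalPair A B E f g)
    (hW : IsSolution (fun n => (A n : ℂ)) (fun n => (B n : ℂ)) z W)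
    (horth : partialSum s (f * g) = 0) :
    ‖wronskian (fun n => (A n : ℂ)) W (fun n => g n) 0‖ ^ 2 * partialSum s (f ^ 2)
        + ‖wronskian (fun n => (A n : ℂ)) (fun n => f n) W 0‖ ^ 2 * partialSum s (g ^ 2)
      ≤ 3 * (1 + 2 * ‖z - E‖ ^ 2 * gram f g s) * partialSum s fun k => ‖W k‖ ^ 2 := by
  set w := partialSum s fun k => ‖W k‖ ^ 2 with hw
  rw [← partialSum_norm_sq_of_orthogonal horth]
  calc _ ≤ partialSum s ((3 : ℝ) • (fun k => ‖W k‖ ^ 2)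
        + (3 * (‖z - E‖ ^ 2 * w * partialSum s (g ^ 2))) • f ^ 2
        + (3 * (‖z - E‖ ^ 2 * w * partialSum s (f ^ 2))) • g ^ 2) := by
        refine partialSum_le_partialSum fun n hn => (h.norm_sq_le hW hn).trans_eq ?_
        simp only [Pi.add_apply, Pi.smul_apply, Pi.pow_apply, smul_eq_mul]
        ring
    _ = _ := by
        simp only [map_add, map_smul, smul_eq_mul, gram, horth, ← hw]
        ring

theorem IsFundamentalPair.abs_im_le_norm_mul_norm (h : IsFundamentalPair A B E f g) (W : ℕ → ℂ) :
    |A 0 * ((starRingEnd ℂ) (W 0) * W 1).im|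
      ≤ ‖wronskian (fun n => (A n : ℂ)) W (fun n => g n) 0‖
        * ‖wronskian (fun n => (A n : ℂ)) (fun n => f n) W 0‖ := by
  have h0 := h.wronskian_zero
  have e : A 0 * ((starRingEnd ℂ) (W 0) * W 1).im
      = ((starRingEnd ℂ) (wronskian (fun n => (A n : ℂ)) (fun n => f n) W 0)
        * wronskian (fun n => (A n : ℂ)) W (fun n => g n) 0).im := by
    simp only [wronskian, Complex.mul_im, Complex.mul_re, Complex.conj_re, Complex.conj_im,
      Complex.sub_re, Complex.sub_im, Complex.ofReal_re, Complex.ofReal_im] at h0 ⊢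
    linear_combination (-A 0 * ((W 0).re * (W 1).im - (W 0).im * (W 1).re)) * h0
  rw [e]
  refine (Complex.abs_im_le_norm _).trans_eq ?_
  rw [norm_mul, RCLike.norm_conj, mul_comm]

theorem IsFundamentalPair.two_mul_sqrt_gram_mul_le (h : IsFundamentalPair A B E f g)
    (hW : IsSolution (fun n => (A n : ℂ)) (fun n => (B n : ℂ)) z W) (s : ℝ) :
    2 * √(gram f g s) * |A 0 * ((starRingEnd ℂ) (W 0) * W 1).im|
      ≤ 3 * (1 + 2 * ‖z - E‖ ^ 2 * gram f g s) * partialSum s fun k => ‖W k‖ ^ 2 := by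
  obtain ⟨t, horth, -⟩ := exists_isMin_rotated f g s
  have hbound := (h.rotated t).norm_sq_add_norm_sq_le_of_orthogonal hW horth
  have him := (h.rotated t).abs_im_le_norm_mul_norm W
  rw [gram_rotated] at hbound
  refine le_trans ?_ hbound
  set u := JacobiDyn.rotated f g t
  set v := JacobiDyn.rotated f g (t + Real.pi / 2)
  have hu := partialSum_sq_nonneg s u
  have hv := partialSum_sq_nonneg s v
  have hgram : √(gram f g s) = √(partialSum s (u ^ 2)) * √(partialSum s (v ^ 2)) := by
    rw [← Real.sqrt_mul hu, ← gram_rotated f g s t, gram, horth, zero_pow two_ne_zero, sub_zero]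
  set α := ‖wronskian (fun n => (A n : ℂ)) W (fun n => v n) 0‖
  set β := ‖wronskian (fun n => (A n : ℂ)) (fun n => u n) W 0‖
  calc 2 * √(gram f g s) * |A 0 * ((starRingEnd ℂ) (W 0) * W 1).im|
      ≤ 2 * (√(partialSum s (u ^ 2)) * √(partialSum s (v ^ 2))) * (α * β) := by
        rw [hgram]
        gcongr
    _ = 2 * (α * √(partialSum s (u ^ 2))) * (β * √(partialSum s (v ^ 2))) := by ring
    _ ≤ (α * √(partialSum s (u ^ 2))) ^ 2 + (β * √(partialSum s (v ^ 2))) ^ 2 :=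
        two_mul_le_add_sq _ _
    _ = _ := by rw [mul_pow, mul_pow, Real.sq_sqrt hu, Real.sq_sqrt hv]

theorem IsFundamentalPair.mul_abs_im_le (h : IsFundamentalPair A B E f g)
    (hW : IsSolution (fun n => (A n : ℂ)) (fun n => (B n : ℂ)) z W) {ε L : ℝ} (hε : 0 < ε)
    (hz : ‖z - E‖ ^ 2 ≤ 2 * ε ^ 2) (hL : ε⁻¹ ≤ √(gram f g L)) :
    2 / 15 * ε⁻¹ * |A 0 * ((starRingEnd ℂ) (W 0) * W 1).im|
      ≤ partialSum L fun k => ‖W k‖ ^ 2 := by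
  obtain ⟨s, hsL, hs⟩ := exists_sqrt_gram_eq (inv_nonneg.2 hε.le) hL
  have hgram : gram f g s = ε⁻¹ ^ 2 := by rw [← hs, Real.sq_sqrt (gram_nonneg f g s)]
  have hmain := h.two_mul_sqrt_gram_mul_le hW s
  have hfactor : 3 * (1 + 2 * ‖z - E‖ ^ 2 * gram f g s) ≤ 15 := by
    have : ‖z - E‖ ^ 2 * gram f g s ≤ 2 := by
      calc ‖z - E‖ ^ 2 * gram f g s ≤ 2 * ε ^ 2 * ε⁻¹ ^ 2 := by rw [hgram]; gcongr
        _ = 2 := by field_simp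
    linarith
  have hW0 : (0 : ℕ → ℝ) ≤ fun k => ‖W k‖ ^ 2 := fun k => sq_nonneg ‖W k‖
  have hle := mul_le_mul hfactor (partialSum_mono_left hsL hW0) (partialSum_nonneg s hW0)
    (by norm_num)
  rw [hs] at hmain
  linarith

end HalfLineBounds

/-! ### Truncated norms as interpolated sums -/

section Restriction

/-- The restriction of a sequence on `ℤ` to the right half-line, together with the boundary
site `0`. -/
def rightHalf {α : Type*} (φ : ℤ → α) (n : ℕ) : α := φ n

/-- The restriction of a sequence on `ℤ` to the left half-line, reflected so that the sites
`0, -1, -2, …` become `1, 2, 3, …` and the boundary site `1` becomes `0`. -/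
def leftHalf {α : Type*} (φ : ℤ → α) (n : ℕ) : α := φ (1 - n)

variable {L : ℝ}

theorem sum_Icc_add_eq_partialSum_rightHalf (c : ℤ → ℝ) (hL : 0 ≤ L) :
    ∑ n ∈ Icc 1 ⌊L⌋, c n + (L - ⌊L⌋) * c (⌊L⌋ + 1) = partialSum L (rightHalf c) := by
  have hsum (m : ℕ) : ∑ n ∈ Icc (1 : ℤ) m, c n = ∑ k ∈ range m, c (k + 1 : ℕ) := by
    refine sum_nbij' (fun n => (n - 1).toNat) (fun k => ((k + 1 : ℕ) : ℤ)) ?_ ?_ ?_ ?_ ?_ <;> grind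
  rw [partialSum_eq_floor hL, ← natCast_floor_eq_intCast_floor hL,
    ← Int.natCast_floor_eq_floor hL, hsum]
  rfl

theorem sum_Icc_neg_add_eq_partialSum (c : ℤ → ℝ) (hL : 0 ≤ L) :
    ∑ n ∈ Icc (-⌊L⌋) (-1), c n + (L - ⌊L⌋) * c (-⌊L⌋ - 1)
      = partialSum L (fun n => c (-n)) := by
  have hsum (m : ℕ) : ∑ n ∈ Icc (-(m : ℤ)) (-1), c n = ∑ k ∈ range m, c (-(k + 1 : ℕ)) := by
    refine sum_nbij' (fun n => (-n - 1).toNat) (fun k => -((k + 1 : ℕ) : ℤ)) ?_ ?_ ?_ ?_ ?_ <;>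
      grind
  rw [partialSum_eq_floor hL, ← natCast_floor_eq_intCast_floor hL,
    ← Int.natCast_floor_eq_floor hL, hsum, Nat.cast_succ, neg_add']

theorem sum_Icc_zero_add_eq_partialSum_leftHalf (c : ℤ → ℝ) (hL : 0 ≤ L) :
    ∑ n ∈ Icc (-⌊L⌋) 0, c n + (L - ⌊L⌋) * c (-⌊L⌋ - 1) = partialSum (L + 1) (leftHalf c) := by
  have hIcc : Icc (-⌊L⌋) 0 = insert 0 (Icc (-⌊L⌋) (-1)) := by
    have := Int.floor_nonneg.2 hL
    grind
  rw [hIcc, sum_insert (by simp), add_assoc, sum_Icc_neg_add_eq_partialSum c hL,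
    partialSum_add_one hL]
  simp [leftHalf]

theorem rightNormSq_eq_partialSum (φ : ℤ → ℝ) (hL : 0 ≤ L) :
    rightNormSq φ L = partialSum L (rightHalf φ ^ 2) :=
  sum_Icc_add_eq_partialSum_rightHalf (fun n => φ n ^ 2) hL

theorem leftNormSq_eq_partialSum (φ : ℤ → ℝ) (hL : 0 ≤ L) :
    leftNormSq φ L = partialSum (L + 1) (leftHalf φ ^ 2) :=
  sum_Icc_zero_add_eq_partialSum_leftHalf (fun n => φ n ^ 2) hL

theorem boxNormSq_eq_partialSum_add (φ : ℤ → ℂ) {L₁ L₂ : ℝ} (h₁ : 0 ≤ L₁) (h₂ : 0 ≤ L₂) :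
    boxNormSq φ L₁ L₂ = partialSum (L₁ + 1) (fun n => ‖leftHalf φ n‖ ^ 2)
      + partialSum L₂ fun n => ‖rightHalf φ n‖ ^ 2 := by
  have hIcc : Icc (-⌊L₁⌋) ⌊L₂⌋ = Icc (-⌊L₁⌋) 0 ∪ Icc 1 ⌊L₂⌋ := by
    have := Int.floor_nonneg.2 h₁
    have := Int.floor_nonneg.2 h₂
    grind
  have hdisj : Disjoint (Icc (-⌊L₁⌋) 0) (Icc 1 ⌊L₂⌋) := by
    rw [disjoint_left]
    grind
  have hleft := sum_Icc_zero_add_eq_partialSum_leftHalf (fun n => ‖φ n‖ ^ 2) h₁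
  have hright := sum_Icc_add_eq_partialSum_rightHalf (fun n => ‖φ n‖ ^ 2) h₂
  unfold leftHalf at hleft ⊢
  unfold rightHalf at hright ⊢
  rw [boxNormSq, hIcc, sum_union hdisj, ← hleft, ← hright]
  ring

theorem rightTransferSq_eq_partialSum (a b : ℤ → ℝ) (E : ℝ) (hL : 1 ≤ L) :
    rightTransferSq a b E L
      = partialSum (L - 1) (fun n => opNorm (transfer a b E n) ^ 2) := by
  have h := sum_Icc_add_eq_partialSum_rightHalf (fun n => opNorm (transfer a b E n) ^ 2)
    (sub_nonneg.2 hL)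
  rw [Int.floor_sub_one] at h
  unfold rightHalf at h
  rw [← h, rightTransferSq, sub_add_cancel, Int.cast_sub, Int.cast_one, sub_sub_sub_cancel_right]

theorem leftTransferSq_eq_partialSum (a b : ℤ → ℝ) (E : ℝ) (hL : 0 ≤ L) :
    leftTransferSq a b E L = partialSum L (fun n => opNorm (transfer a b E (-n)) ^ 2) :=
  sum_Icc_neg_add_eq_partialSum (fun n => opNorm (transfer a b E n) ^ 2) hL

end Restriction

/-! ### Length scales -/

section Scales

theorem le_of_sInf_le {F : ℝ → ℝ} {l y L : ℝ} (hF : Continuous F) (hmono : Monotone F)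
    (hl : F l ≤ y) (hy : ∃ x, y < F x) (h : sInf {x | l ≤ x ∧ F x = y} ≤ L) : y ≤ F L := by
  obtain ⟨x, hx⟩ := hy
  have hlx : l ≤ x := le_of_lt (hmono.reflect_lt (hl.trans_lt hx))
  have hne : {x | l ≤ x ∧ F x = y}.Nonempty := by
    obtain ⟨t, ht, hty⟩ := intermediate_value_Icc hlx hF.continuousOn ⟨hl, hx.le⟩
    exact ⟨t, ht.1, hty⟩
  have hclosed : IsClosed {x | l ≤ x ∧ F x = y} :=
    isClosed_Ici.inter (isClosed_eq hF continuous_const)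
  exact (hclosed.csInf_mem hne ⟨l, fun _ ht => ht.1⟩).2.symm.le.trans (hmono h)

theorem rightPair_eq (a b : ℤ → ℝ) (E θ : ℝ) (n : ℕ) :
    rightPair a b E θ n = Real.cos θ • rightPair a b E 0 n
      + Real.sin θ • rightPair a b E (Real.pi / 2) n := by
  induction n with
  | zero => simp [rightPair]
  | succ n ih =>
    simp only [rightPair, ih]
    ext
    · simp
    · simp only [Prod.fst_add, Prod.snd_add, Prod.smul_fst, Prod.smul_snd, smul_eq_mul]
      ring

theorem leftPair_eq (a b : ℤ → ℝ) (E θ : ℝ) (n : ℕ) :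
    leftPair a b E θ n = Real.cos θ • leftPair a b E 0 n
      + Real.sin θ • leftPair a b E (Real.pi / 2) n := by
  induction n with
  | zero => simp [leftPair]
  | succ n ih =>
    simp only [leftPair, ih]
    ext
    · simp only [Prod.fst_add, Prod.snd_add, Prod.smul_fst, Prod.smul_snd, smul_eq_mul]
      ring
    · simp

theorem sol_eq (a b : ℤ → ℝ) (E θ : ℝ) (n : ℤ) :
    sol a b E θ n = Real.cos θ * sol a b E 0 n + Real.sin θ * sol a b E (Real.pi / 2) n := by
  cases n with
  | ofNat n => simp [sol, rightPair_eq a b E θ n]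
  | negSucc n => simp [sol, leftPair_eq a b E θ (n + 1)]

theorem normalized_zero (a : ℤ → ℝ) : normalized a 0 = 1 := Function.update_self ..

theorem normalized_of_ne (a : ℤ → ℝ) {n : ℤ} (hn : n ≠ 0) : normalized a n = a n :=
  Function.update_of_ne hn ..

variable {a : ℤ → ℝ}

theorem normalized_ne_zero (ha : ∀ n, a n ≠ 0) (n : ℤ) : normalized a n ≠ 0 := by
  obtain rfl | hn := eq_or_ne n 0
  · rw [normalized_zero]
    exact one_ne_zero
  · rw [normalized_of_ne a hn]
    exact ha n

/-- The solution `u_θ` with coefficients `normalized a` on the right half-line. -/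
def rightSol (a b : ℤ → ℝ) (E θ : ℝ) : ℕ → ℝ := rightHalf (sol (normalized a) b E θ)

/-- The solution `u_θ` with coefficients `normalized a` on the left half-line. -/
def leftSol (a b : ℤ → ℝ) (E θ : ℝ) : ℕ → ℝ := leftHalf (sol (normalized a) b E θ)

theorem isFundamentalPair_right (ha : ∀ n, a n ≠ 0) (b : ℤ → ℝ) (E : ℝ) :
    IsFundamentalPair (rightHalf (normalized a)) (rightHalf b) E
      (rightSol a b E 0) (rightSol a b E (Real.pi / 2)) := by
  have hsol (θ : ℝ) : IsSolution (rightHalf (normalized a)) (rightHalf b) E (rightSol a b E θ) :=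
    fun n => by
      have h := sol_equation (normalized a) b (normalized_ne_zero ha) E θ (n + 1)
      simp only [rightSol, rightHalf]
      push_cast
      rw [add_sub_cancel_right] at h
      rw [show (n : ℤ) + 2 = n + 1 + 1 by ring]
      exact h
  refine ⟨hsol _, hsol _, ?_⟩
  simp [wronskian, rightSol, rightHalf, normalized_zero, sol_zero, sol_one]

theorem isFundamentalPair_left (ha : ∀ n, a n ≠ 0) (b : ℤ → ℝ) (E : ℝ) :
    IsFundamentalPair (fun n => normalized a (-n)) (leftHalf b) E
      (leftSol a b E (Real.pi / 2)) (leftSol a b E 0) := by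
  have hsol (θ : ℝ) : IsSolution (fun n => normalized a (-n)) (leftHalf b) E (leftSol a b E θ) :=
    fun n => by
      have h := sol_equation (normalized a) b (normalized_ne_zero ha) E θ (-n)
      simp only [leftSol, leftHalf]
      push_cast
      rw [show 1 - ((n : ℤ) + 2) = -n - 1 by ring, show 1 - ((n : ℤ) + 1) = -n by ring,
        show -((n : ℤ) + 1) = -n - 1 by ring, show 1 - (n : ℤ) = -n + 1 by ring]
      linarith
  refine ⟨hsol _, hsol _, ?_⟩
  simp [wronskian, leftSol, leftHalf, normalized_zero, sol_zero, sol_one]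

theorem rotated_rightSol (a b : ℤ → ℝ) (E θ : ℝ) :
    rotated (rightSol a b E 0) (rightSol a b E (Real.pi / 2)) θ = rightSol a b E θ :=
  funext fun n => (sol_eq (normalized a) b E θ n).symm

theorem rotated_leftSol (a b : ℤ → ℝ) (E θ : ℝ) :
    rotated (leftSol a b E 0) (leftSol a b E (Real.pi / 2)) θ = leftSol a b E θ :=
  funext fun n => (sol_eq (normalized a) b E θ (1 - n)).symm

/-- The Gram determinant of `u_0` and `u_{π/2}` on the right half-line. -/
def rightGram (a b : ℤ → ℝ) (E : ℝ) : ℝ → ℝ :=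
  gram (rightSol a b E 0) (rightSol a b E (Real.pi / 2))

/-- The Gram determinant of `u_{π/2}` and `u_0` on the left half-line. -/
def leftGram (a b : ℤ → ℝ) (E : ℝ) : ℝ → ℝ :=
  gram (leftSol a b E (Real.pi / 2)) (leftSol a b E 0)

theorem IsJacobiData.not_summable_rightHalf (ha : IsJacobiData a) :
    ¬ Summable fun n : ℕ => |rightHalf (normalized a) (n + 1)|⁻¹ := by
  convert ha.diverges_right using 5 with n
  exact normalized_of_ne a (by omega)

theorem IsJacobiData.exists_lt_sqrt_rightGram (ha : IsJacobiData a) (b : ℤ → ℝ) (E y : ℝ) :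
    ∃ s, y < √(rightGram a b E s) :=
  (isFundamentalPair_right ha.ne_zero b E).exists_lt_sqrt_gram ha.not_summable_rightHalf y

theorem IsJacobiData.not_summable_leftHalf (ha : IsJacobiData a) :
    ¬ Summable fun n : ℕ => |normalized a (-((n + 1 : ℕ) : ℤ))|⁻¹ := by
  convert ha.diverges_left using 5 with n
  exact normalized_of_ne a (by omega)

theorem IsJacobiData.exists_lt_sqrt_leftGram (ha : IsJacobiData a) (b : ℤ → ℝ) (E y : ℝ) :
    ∃ s, y < √(leftGram a b E s) :=
  (isFundamentalPair_left ha.ne_zero b E).exists_lt_sqrt_gram ha.not_summable_leftHalf y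

variable {E ε L : ℝ}

theorem inv_le_sqrt_rightGram (ha : IsJacobiData a) (b : ℤ → ℝ) (hε : 0 < ε)
    (h : scaleRight a b ε E ≤ L) : ε⁻¹ ≤ √(rightGram a b E L) := by
  refine le_of_sInf_le (F := fun L => √(rightGram a b E L)) (l := 0) (continuous_gram _ _).sqrt
    (fun s t hst => Real.sqrt_le_sqrt (gram_monotone _ _ hst)) ?_
    (ha.exists_lt_sqrt_rightGram b E _) ?_
  · rw [rightGram, gram_eq_zero_of_le_one zero_le_one, Real.sqrt_zero]
    positivity
  · refine (congrArg sInf ?_).trans_le h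
    ext s
    refine and_congr_right fun hs => ?_
    rw [rightGram, ← iSup_sqrt_mul_iInf_sqrt_rotated]
    simp only [rotated_rightSol, rightNormSq_eq_partialSum _ hs]
    rfl

theorem gram_comm (f g : ℕ → ℝ) : gram f g = gram g f := by
  funext s
  simp only [gram, mul_comm]

theorem inv_le_sqrt_leftGram (ha : IsJacobiData a) (b : ℤ → ℝ) (hε : 0 < ε)
    (h : scaleLeft a b ε E ≤ L) : ε⁻¹ ≤ √(leftGram a b E (L + 1)) := by
  obtain ⟨s, hs⟩ := ha.exists_lt_sqrt_leftGram b E ε⁻¹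
  refine le_of_sInf_le (F := fun L => √(leftGram a b E (L + 1))) (l := 0)
    ((continuous_gram _ _).comp (continuous_add_const 1)).sqrt
    (fun s t hst => Real.sqrt_le_sqrt (gram_monotone _ _ (by gcongr))) ?_
    ⟨s - 1, by rwa [sub_add_cancel]⟩ ?_
  · rw [leftGram, gram_eq_zero_of_le_one (zero_add _).le, Real.sqrt_zero]
    positivity
  · refine (congrArg sInf ?_).trans_le h
    ext s
    refine and_congr_right fun hs => ?_
    rw [leftGram, gram_comm, ← iSup_sqrt_mul_iInf_sqrt_rotated]
    simp only [rotated_leftSol, leftNormSq_eq_partialSum _ hs]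
    rfl

end Scales

/-! ### Transfer matrices -/

section Transfer

open Matrix

theorem opNorm_nonneg (M : Matrix (Fin 2) (Fin 2) ℝ) : 0 ≤ opNorm M := norm_nonneg _

theorem sum_mulVec_sq_le (M : Matrix (Fin 2) (Fin 2) ℝ) (x : Fin 2 → ℝ) :
    ∑ i, (M *ᵥ x) i ^ 2 ≤ opNorm M ^ 2 * ∑ i, x i ^ 2 := by
  have h := (toEuclideanCLM (n := Fin 2) (𝕜 := ℝ) M).le_opNorm (WithLp.toLp 2 x)
  have hsq := pow_le_pow_left₀ (norm_nonneg _) h 2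
  rwa [mul_pow, EuclideanSpace.real_norm_sq_eq, EuclideanSpace.real_norm_sq_eq,
    ofLp_toEuclideanCLM] at hsq

theorem opNorm_le_of_sum_mulVec_sq_le {M : Matrix (Fin 2) (Fin 2) ℝ} {c : ℝ} (hc : 0 ≤ c)
    (h : ∀ x : Fin 2 → ℝ, ∑ i, (M *ᵥ x) i ^ 2 ≤ c ^ 2 * ∑ i, x i ^ 2) : opNorm M ≤ c := by
  refine ContinuousLinearMap.opNorm_le_bound _ hc fun v => ?_
  refine le_of_sq_le_sq ?_ (by positivity)
  rw [mul_pow, EuclideanSpace.real_norm_sq_eq, EuclideanSpace.real_norm_sq_eq, ofLp_toEuclideanCLM]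
  exact h v.ofLp

theorem opNorm_sq_le_sum_sq (M : Matrix (Fin 2) (Fin 2) ℝ) :
    opNorm M ^ 2 ≤ ∑ i, ∑ j, M i j ^ 2 := by
  rw [← Real.le_sqrt (opNorm_nonneg M) (by positivity)]
  refine opNorm_le_of_sum_mulVec_sq_le (Real.sqrt_nonneg _) fun x => ?_
  rw [Real.sq_sqrt (by positivity), sum_mul]
  exact sum_le_sum fun i _ => sum_mul_sq_le_sq_mul_sq univ (M i) x

theorem sum_sq_le_two_mul_opNorm_sq (M : Matrix (Fin 2) (Fin 2) ℝ) :
    ∑ i, ∑ j, M i j ^ 2 ≤ 2 * opNorm M ^ 2 := by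
  have hcol (j : Fin 2) : ∑ i, M i j ^ 2 ≤ opNorm M ^ 2 := by
    simpa [Pi.single_apply] using sum_mulVec_sq_le M (Pi.single j 1)
  rw [sum_comm]
  simpa using sum_le_card_nsmul univ _ _ fun j _ => hcol j

theorem sum_sq_le_opNorm_inv_mul {M : Matrix (Fin 2) (Fin 2) ℝ} (hM : IsUnit M.det)
    (x : Fin 2 → ℝ) : ∑ i, x i ^ 2 ≤ opNorm M⁻¹ ^ 2 * ∑ i, (M *ᵥ x) i ^ 2 := by
  have h := sum_mulVec_sq_le M⁻¹ (M *ᵥ x)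
  rwa [mulVec_mulVec, nonsing_inv_mul M hM, one_mulVec] at h

theorem opNorm_submatrix (M : Matrix (Fin 2) (Fin 2) ℝ) (σ τ : Equiv.Perm (Fin 2)) :
    opNorm (M.submatrix σ τ) = opNorm M := by
  have hle (M : Matrix (Fin 2) (Fin 2) ℝ) (σ τ : Equiv.Perm (Fin 2)) :
      opNorm (M.submatrix σ τ) ≤ opNorm M := by
    refine opNorm_le_of_sum_mulVec_sq_le (opNorm_nonneg M) fun x => ?_
    rw [submatrix_mulVec_equiv, ← Equiv.sum_comp τ.symm fun i => x i ^ 2]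
    exact (Equiv.sum_comp σ fun i => (M *ᵥ (x ∘ τ.symm)) i ^ 2).trans_le (sum_mulVec_sq_le M _)
  refine (hle M σ τ).antisymm ?_
  simpa using hle (M.submatrix σ τ) σ.symm τ.symm

/-- The transfer matrix `(f(n+1) g(n+1); f(n) g(n))` of a pair of solutions on a half-line. -/
def halfTransfer (f g : ℕ → ℝ) (n : ℕ) : Matrix (Fin 2) (Fin 2) ℝ :=
  !![f (n + 1), g (n + 1); f n, g n]

variable {A B f g : ℕ → ℝ} {E ε s : ℝ}

theorem IsFundamentalPair.isUnit_det_halfTransfer (h : IsFundamentalPair A B E f g) (n : ℕ) :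
    IsUnit (halfTransfer f g n).det := by
  have hdet : A n * (halfTransfer f g n).det = 1 := by
    rw [← h.wronskian_eq_one n, halfTransfer, det_fin_two_of, wronskian]
    ring
  exact .of_mul_eq_one_right _ hdet

theorem halfTransfer_mulVec (f g : ℕ → ℝ) (n : ℕ) (θ : ℝ) :
    halfTransfer f g n *ᵥ ![Real.cos θ, Real.sin θ]
      = ![rotated f g θ (n + 1), rotated f g θ n] := by
  ext i
  fin_cases i <;> simp [halfTransfer, rotated]

theorem partialSum_opNorm_halfTransfer_sq_le (f g : ℕ → ℝ) (hs : 0 ≤ s) :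
    partialSum s (fun n => opNorm (halfTransfer f g n) ^ 2)
      ≤ 2 * (partialSum (s + 1) (f ^ 2) + partialSum (s + 1) (g ^ 2)) := by
  have hc : 0 ≤ f ^ 2 + g ^ 2 := fun n => add_nonneg (sq_nonneg (f n)) (sq_nonneg (g n))
  have hshift := partialSum_add_one hs (f ^ 2 + g ^ 2)
  calc partialSum s (fun n => opNorm (halfTransfer f g n) ^ 2)
      ≤ partialSum s ((fun n => (f ^ 2 + g ^ 2) (n + 1)) + (f ^ 2 + g ^ 2)) := by
        refine partialSum_le_partialSum fun n _ => (opNorm_sq_le_sum_sq _).trans_eq ?_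
        simp [halfTransfer, Fin.sum_univ_two]
    _ ≤ partialSum (s + 1) (f ^ 2 + g ^ 2) + partialSum (s + 1) (f ^ 2 + g ^ 2) := by
        rw [map_add]
        gcongr
        · exact (le_add_of_nonneg_left (hc 1)).trans_eq hshift.symm
        · exact partialSum_mono_left (by linarith) hc
    _ = _ := by rw [map_add, two_mul]

theorem IsFundamentalPair.inv_le_sqrt_gram_of_halfTransfer (h : IsFundamentalPair A B E f g)
    (hε : 0 < ε) (hs : 1 ≤ s) (hle : 2 * opNorm (halfTransfer f g 1)⁻¹ * ε⁻¹
      ≤ √(partialSum s fun n => opNorm (halfTransfer f g n) ^ 2)) :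
    ε⁻¹ ≤ √(gram f g (s + 1)) := by
  obtain ⟨t, horth, hmin⟩ := exists_isMin_rotated f g (s + 1)
  have hsum := partialSum_rotated_sq_add f g (s + 1) t
  have hgram := gram_rotated f g (s + 1) t
  have hle_max := hmin (t + Real.pi / 2)
  rw [gram, horth, zero_pow two_ne_zero, sub_zero] at hgram
  set κ := opNorm (halfTransfer f g 1)⁻¹
  set m := partialSum (s + 1) (JacobiDyn.rotated f g t ^ 2)
  set M := partialSum (s + 1) (JacobiDyn.rotated f g (t + Real.pi / 2) ^ 2)
  have hm1 : 1 ≤ κ ^ 2 * m := by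
    have hκ := sum_sq_le_opNorm_inv_mul (h.isUnit_det_halfTransfer 1) ![Real.cos t, Real.sin t]
    have hm2 := sum_range_le_partialSum (n := 2) (s := s + 1) (by push_cast; linarith)
      fun n => sq_nonneg (JacobiDyn.rotated f g t n)
    simp only [halfTransfer_mulVec, Fin.sum_univ_two, cons_val_zero, cons_val_one,
      Real.cos_sq_add_sin_sq] at hκ
    simp only [sum_range_succ, sum_range_zero, zero_add, Nat.reduceAdd] at hm2
    refine hκ.trans ?_
    gcongr
    rw [add_comm]
    exact hm2
  have hM : κ ^ 2 * ε⁻¹ ^ 2 ≤ M := by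
    have hκ0 : 0 ≤ 2 * κ * ε⁻¹ :=
      mul_nonneg (mul_nonneg two_pos.le (opNorm_nonneg _)) (inv_nonneg.2 hε.le)
    have hsq := ((Real.le_sqrt hκ0 (partialSum_nonneg s fun n =>
      sq_nonneg (opNorm _))).1 hle).trans
      (partialSum_opNorm_halfTransfer_sq_le f g (by linarith))
    linarith
  refine Real.le_sqrt_of_sq_le ?_
  calc ε⁻¹ ^ 2 ≤ κ ^ 2 * m * ε⁻¹ ^ 2 := le_mul_of_one_le_left (by positivity) hm1
    _ = m * (κ ^ 2 * ε⁻¹ ^ 2) := by ring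
    _ ≤ m * M := by
      gcongr
      exact partialSum_sq_nonneg _ _
    _ = gram f g (s + 1) := hgram

theorem IsFundamentalPair.exists_lt_sqrt_partialSum_opNorm_halfTransfer_sq
    (h : IsFundamentalPair A B E f g) (hA : ¬ Summable fun n => |A (n + 1)|⁻¹) (y : ℝ) :
    ∃ s, y < √(partialSum s fun n => opNorm (halfTransfer f g n) ^ 2) := by
  have hinv (n : ℕ) : |A n|⁻¹ ≤ opNorm (halfTransfer f g n) ^ 2 := by
    have hfrob : f (n + 1) ^ 2 + g (n + 1) ^ 2 + (f n ^ 2 + g n ^ 2)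
        ≤ 2 * opNorm (halfTransfer f g n) ^ 2 := by
      simpa [halfTransfer] using sum_sq_le_two_mul_opNorm_sq (halfTransfer f g n)
    rw [h.abs_inv_eq, abs_le]
    constructor
    · nlinarith [sq_nonneg (f (n + 1) + g n), sq_nonneg (f n - g (n + 1))]
    · nlinarith [sq_nonneg (f (n + 1) - g n), sq_nonneg (f n + g (n + 1))]
  by_contra! hle
  refine hA (summable_of_sum_range_le (c := y ^ 2) (fun n => by positivity) fun n => ?_)
  calc ∑ k ∈ range n, |A (k + 1)|⁻¹ ≤ ∑ k ∈ range n, opNorm (halfTransfer f g (k + 1)) ^ 2 :=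
        sum_le_sum fun k _ => hinv _
    _ = partialSum n fun k => opNorm (halfTransfer f g k) ^ 2 := by rw [partialSum_natCast]
    _ ≤ y ^ 2 := (Real.sqrt_le_iff.1 (hle n)).2

theorem transfer_eq_halfTransfer (a b : ℤ → ℝ) (E : ℝ) (n : ℕ) :
    transfer (normalized a) b E n
      = halfTransfer (rightSol a b E 0) (rightSol a b E (Real.pi / 2)) n := by
  simp [transfer, halfTransfer, rightSol, rightHalf]

theorem transfer_neg_eq_halfTransfer_submatrix (a b : ℤ → ℝ) (E : ℝ) (n : ℕ) :
    transfer (normalized a) b E (-n)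
      = (halfTransfer (leftSol a b E (Real.pi / 2)) (leftSol a b E 0) n).submatrix
        (Equiv.swap 0 1) (Equiv.swap 0 1) := by
  ext i j
  fin_cases i <;> fin_cases j <;> simp [transfer, halfTransfer, leftSol, leftHalf] <;> ring_nf

theorem opNorm_transfer_neg (a b : ℤ → ℝ) (E : ℝ) (n : ℕ) :
    opNorm (transfer (normalized a) b E (-n))
      = opNorm (halfTransfer (leftSol a b E (Real.pi / 2)) (leftSol a b E 0) n) := by
  rw [transfer_neg_eq_halfTransfer_submatrix, opNorm_submatrix]

theorem opNorm_inv_transfer_neg (a b : ℤ → ℝ) (E : ℝ) (n : ℕ) :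
    opNorm (transfer (normalized a) b E (-n))⁻¹
      = opNorm (halfTransfer (leftSol a b E (Real.pi / 2)) (leftSol a b E 0) n)⁻¹ := by
  rw [transfer_neg_eq_halfTransfer_submatrix, inv_submatrix_equiv, opNorm_submatrix]

variable {a : ℤ → ℝ} {L : ℝ}

theorem inv_le_sqrt_gram_of_sInf_le {l : ℝ} (h : IsFundamentalPair A B E f g)
    (hA : ¬ Summable fun n => |A (n + 1)|⁻¹) (hε : 0 < ε) (hL : l + 1 ≤ L)
    (hle : sInf {x | l ≤ x ∧ √(partialSum (x - l) fun n => opNorm (halfTransfer f g n) ^ 2)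
      = 2 * opNorm (halfTransfer f g 1)⁻¹ * ε⁻¹} ≤ L) : ε⁻¹ ≤ √(gram f g (L - l + 1)) := by
  obtain ⟨s, hs⟩ := h.exists_lt_sqrt_partialSum_opNorm_halfTransfer_sq hA
    (2 * opNorm (halfTransfer f g 1)⁻¹ * ε⁻¹)
  have hκ : 0 ≤ 2 * opNorm (halfTransfer f g 1)⁻¹ * ε⁻¹ :=
    mul_nonneg (mul_nonneg two_pos.le (opNorm_nonneg _)) (inv_nonneg.2 hε.le)
  refine h.inv_le_sqrt_gram_of_halfTransfer hε (by linarith) ?_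
  refine le_of_sInf_le
    (F := fun x => √(partialSum (x - l) fun n => opNorm (halfTransfer f g n) ^ 2))
    ((continuous_partialSum _).comp (continuous_sub_right l)).sqrt (fun s t hst => ?_) ?_
    ⟨s + l, by rwa [add_sub_cancel_right]⟩ hle
  · exact Real.sqrt_le_sqrt
      (partialSum_mono_left (sub_le_sub_right hst l) fun n => sq_nonneg (opNorm _))
  · rwa [sub_self, partialSum_eq_zero_of_nonpos le_rfl, Real.sqrt_zero]

theorem inv_le_sqrt_rightGram_of_transferScaleRight_le (ha : IsJacobiData a) (b : ℤ → ℝ)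
    (hε : 0 < ε) (h : transferScaleRight a b ε E ≤ L) (hL : 2 ≤ L) :
    ε⁻¹ ≤ √(rightGram a b E L) := by
  rw [← sub_add_cancel L 1]
  refine inv_le_sqrt_gram_of_sInf_le (isFundamentalPair_right ha.ne_zero b E)
    ha.not_summable_rightHalf hε (by linarith) ((congrArg sInf ?_).trans_le h)
  ext s
  refine and_congr_right fun hs => ?_
  rw [rightTransferSq_eq_partialSum _ _ _ hs]
  have h1 := transfer_eq_halfTransfer a b E 1
  rw [Nat.cast_one] at h1
  simp only [h1, transfer_eq_halfTransfer]

theorem inv_le_sqrt_leftGram_of_transferScaleLeft_le (ha : IsJacobiData a) (b : ℤ → ℝ)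
    (hε : 0 < ε) (h : transferScaleLeft a b ε E ≤ L) (hL : 1 ≤ L) :
    ε⁻¹ ≤ √(leftGram a b E (L + 1)) := by
  rw [← sub_zero L]
  refine inv_le_sqrt_gram_of_sInf_le (isFundamentalPair_left ha.ne_zero b E)
    ha.not_summable_leftHalf hε (by linarith) ((congrArg sInf ?_).trans_le h)
  ext s
  refine and_congr_right fun hs => ?_
  rw [leftTransferSq_eq_partialSum _ _ _ hs, sub_zero]
  have h1 := opNorm_inv_transfer_neg a b E 1
  rw [Nat.cast_one] at h1
  simp only [h1, opNorm_transfer_neg]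

end Transfer

/-! ### Symmetry of the operator -/

section Symmetry

open Filter Topology
theorem eq_zero_of_tendsto_of_not_summable {A J p : ℕ → ℝ} {l : ℝ} (hA : ∀ n, A n ≠ 0)
    (hdiv : ¬ Summable fun n => |A n|⁻¹) (hp : Summable p) (hJ : ∀ n, |J n| ≤ |A n| * p n)
    (hl : Tendsto J atTop (𝓝 l)) : l = 0 := by
  by_contra hne
  have hl0 : 0 < |l| := abs_pos.2 hne
  have hev : ∀ᶠ n in atTop, |l| / 2 < |J n| := hl.abs.eventually_const_lt (by linarith)
  refine hdiv (Summable.of_norm_bounded_eventually_nat (hp.mul_left (2 / |l|)) ?_)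
  filter_upwards [hev] with n hn
  rw [norm_inv, Real.norm_eq_abs, abs_abs, inv_le_iff_one_le_mul₀ (abs_pos.2 (hA n))]
  calc (1 : ℝ) = 2 / |l| * (|l| / 2) := by field_simp
    _ ≤ 2 / |l| * (|A n| * p n) := by gcongr; exact hn.le.trans (hJ n)
    _ = 2 / |l| * p n * |A n| := by ring

theorem exists_tendsto_of_hasSum_sub {J : ℤ → ℝ} {s : ℝ}
    (h : HasSum (fun n => J n - J (n - 1)) s) :
    ∃ r l, Tendsto (fun n : ℕ => J n) atTop (𝓝 r) ∧ Tendsto (fun n : ℕ => J (-n)) atTop (𝓝 l) ∧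
      s = r - l := by
  have hshift : HasSum (fun n : ℤ => J (n + 1) - J n) s := by
    simpa [Function.comp_def] using (Equiv.addRight (1 : ℤ)).hasSum_iff.2 h
  have hright : Summable fun n : ℕ => J (n + 1) - J n :=
    hshift.summable.comp_injective (i := fun n : ℕ => (n : ℤ)) Nat.cast_injective
  have hleft : Summable fun n : ℕ => J (-(n + 1 : ℤ) + 1) - J (-(n + 1)) :=
    hshift.summable.comp_injective (i := fun n : ℕ => -(n + 1 : ℤ)) fun m n h => by simpa using h
  obtain ⟨r, hr⟩ := hright
  obtain ⟨l, hl⟩ := hleft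
  have er (N : ℕ) : ∑ n ∈ range N, (J (n + 1) - J n) = J N - J 0 := by
    exact_mod_cast sum_range_sub (fun n : ℕ => J n) N
  have el (N : ℕ) : ∑ n ∈ range N, (J (-(n + 1 : ℤ) + 1) - J (-(n + 1))) = J 0 - J (-N) := by
    simpa [add_comm] using sum_range_sub' (fun n : ℕ => J (-n)) N
  have htr := hr.tendsto_sum_nat
  have htl := hl.tendsto_sum_nat
  simp only [er] at htr
  simp only [el] at htl
  refine ⟨r + J 0, J 0 - l, by simpa using htr.add_const (J 0),
    by simpa using htl.const_sub (J 0), ?_⟩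
  rw [hshift.unique (HasSum.of_nat_of_neg_add_one (f := fun n : ℤ => J (n + 1) - J n) hr hl)]
  ring

/-- The current of `u` from site `n` to site `n + 1`: the Wronskian of `u` and its complex
conjugate, up to a factor. -/
def current (a : ℤ → ℝ) (u : ℤ → ℂ) (n : ℤ) : ℝ :=
  a n * ((starRingEnd ℂ) (u n) * u (n + 1)).im

theorem im_inner_jacobiExpr (a b : ℤ → ℝ) (u : ℤ → ℂ) (n : ℤ) :
    (inner ℂ (u n) (jacobiExpr a b u n)).im = current a u n - current a u (n - 1) := by
  simp only [current, jacobiExpr, RCLike.inner_apply, sub_add_cancel, Complex.mul_im,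
    Complex.mul_re, Complex.add_re, Complex.add_im, Complex.conj_re, Complex.conj_im,
    Complex.ofReal_re, Complex.ofReal_im]
  ring

theorem abs_current_le (a : ℤ → ℝ) (u : ℤ → ℂ) (n : ℤ) :
    |current a u n| ≤ |a n| * (‖u n‖ * ‖u (n + 1)‖) := by
  rw [current, abs_mul]
  gcongr
  exact (Complex.abs_im_le_norm _).trans_eq (by rw [norm_mul, RCLike.norm_conj])

theorem summable_norm_sq (u : ℓ²(ℤ, ℂ)) : Summable fun n => ‖u n‖ ^ 2 := by
  simpa using (lp.memℓp u).summable (by norm_num)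

theorem summable_norm_mul_norm_succ (u : ℓ²(ℤ, ℂ)) :
    Summable fun n : ℤ => ‖u n‖ * ‖u (n + 1)‖ := by
  have h := summable_norm_sq u
  have hsucc : Summable fun n : ℤ => ‖u (n + 1)‖ ^ 2 :=
    h.comp_injective (add_left_injective (1 : ℤ))
  refine (h.add hsucc).of_nonneg_of_le (fun n => by positivity) fun n => ?_
  nlinarith [sq_nonneg (‖u n‖ - ‖u (n + 1)‖), sq_nonneg ‖u n‖, sq_nonneg ‖u (n + 1)‖]

variable {a b : ℤ → ℝ}

theorem IsJacobiData.im_inner_jacobiOperator (ha : IsJacobiData a)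
    (u : (jacobiOperator a b).domain) :
    (inner ℂ (u : ℓ²(ℤ, ℂ)) (jacobiOperator a b u)).im = 0 := by
  set v : ℓ²(ℤ, ℂ) := u.1
  have hsum : HasSum (fun n => current a v n - current a v (n - 1))
      (inner ℂ v (jacobiOperator a b u)).im := by
    simp only [← im_inner_jacobiExpr a b]
    exact Complex.hasSum_im (lp.hasSum_inner v (jacobiOperator a b u))
  obtain ⟨r, l, hr, hl, hrl⟩ := exists_tendsto_of_hasSum_sub hsum
  have hp := summable_norm_mul_norm_succ v
  have hr0 : r = 0 := eq_zero_of_tendsto_of_not_summable (fun n => ha.ne_zero _)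
    ha.diverges_right (hp.comp_injective fun m n h => by simpa using h)
    (fun n => abs_current_le a v _) (by exact_mod_cast hr.comp (tendsto_add_atTop_nat 1))
  have hl0 : l = 0 := eq_zero_of_tendsto_of_not_summable (fun n => ha.ne_zero _)
    ha.diverges_left (hp.comp_injective fun m n h => by simpa using h)
    (fun n => abs_current_le a v _) (by exact_mod_cast hl.comp (tendsto_add_atTop_nat 1))
  rw [hrl, hr0, hl0, sub_zero]

theorem IsJacobiData.eq_zero_of_jacobiOperator_eq_smul (ha : IsJacobiData a) {z : ℂ}
    (hz : z.im ≠ 0) (u : (jacobiOperator a b).domain)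
    (hu : jacobiOperator a b u = z • (u : ℓ²(ℤ, ℂ))) : (u : ℓ²(ℤ, ℂ)) = 0 := by
  have h := ha.im_inner_jacobiOperator u
  have hnorm : inner ℂ (u : ℓ²(ℤ, ℂ)) u = ((‖(u : ℓ²(ℤ, ℂ))‖ ^ 2 : ℝ) : ℂ) := by
    rw [inner_self_eq_norm_sq_to_K]
    norm_cast
  rw [hu, inner_smul_right, hnorm, Complex.im_mul_ofReal] at h
  simpa [hz] using h

end Symmetry

/-! ### The Laplace transform and Plancherel's theorem -/

section Laplace

open MeasureTheory Filter Topology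

variable {X Y : Type*} [NormedAddCommGroup X] [NormedSpace ℂ X] [NormedAddCommGroup Y]
  [NormedSpace ℂ Y]

/-- The Laplace transform `i ∫₀^∞ e^{izt} φ(t) dt` on the upper half-plane, normalized so that it
sends `t ↦ e^{-iHt} φ` to `z ↦ (H - z)⁻¹ φ`. -/
def laplace (φ : ℝ → X) (z : ℂ) : X :=
  Complex.I • ∫ t in Set.Ioi (0 : ℝ), Complex.exp (Complex.I * z * t) • φ t

theorem norm_exp_I_mul (z : ℂ) (t : ℝ) :
    ‖Complex.exp (Complex.I * z * t)‖ = Real.exp (-z.im * t) := by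
  simp [Complex.norm_exp]

theorem hasDerivAt_exp_I_mul (z : ℂ) (t : ℝ) :
    HasDerivAt (fun t : ℝ => Complex.exp (Complex.I * z * t))
      (Complex.I * z * Complex.exp (Complex.I * z * t)) t := by
  have h : HasDerivAt (fun t : ℝ => Complex.I * z * (t : ℂ)) (Complex.I * z) t := by
    simpa using (Complex.ofRealCLM.hasDerivAt (x := t)).const_mul (Complex.I * z)
  simpa [mul_comm] using h.cexp

theorem tendsto_exp_I_mul_smul_atTop {φ : ℝ → X} {K : ℝ} (hK : ∀ t, ‖φ t‖ ≤ K) {z : ℂ}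
    (hz : 0 < z.im) :
    Tendsto (fun t : ℝ => Complex.exp (Complex.I * z * t) • φ t) atTop (𝓝 0) := by
  have hexp : Tendsto (fun t => Real.exp (-z.im * t) * K) atTop (𝓝 (0 * K)) :=
    (Real.tendsto_exp_atBot.comp (tendsto_id.const_mul_atTop_of_neg (by linarith))).mul_const K
  rw [zero_mul] at hexp
  refine squeeze_zero_norm (fun t => ?_) hexp
  rw [norm_smul, norm_exp_I_mul]
  gcongr
  exact hK t

theorem integrableOn_exp_I_mul_smul [SecondCountableTopologyEither ℝ X] {φ : ℝ → X}
    (hφ : Continuous φ) {K : ℝ} (hK : ∀ t, ‖φ t‖ ≤ K) {z : ℂ} (hz : 0 < z.im) :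
    IntegrableOn (fun t : ℝ => Complex.exp (Complex.I * z * t) • φ t) (Set.Ioi 0) := by
  refine ((exp_neg_integrableOn_Ioi 0 hz).mul_const K).mono'
    (Continuous.aestronglyMeasurable (by fun_prop)) (Eventually.of_forall fun t => ?_)
  rw [norm_smul, norm_exp_I_mul]
  gcongr
  exact hK t

theorem laplace_const_smul (φ : ℝ → X) (c z : ℂ) :
    laplace (fun t => c • φ t) z = c • laplace φ z := by
  simp only [laplace, smul_comm _ c, integral_smul]

variable [CompleteSpace X]

theorem map_laplace [CompleteSpace Y] (Λ : X →L[ℂ] Y) {φ : ℝ → X} (hφ : Continuous φ)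
    {K : ℝ} (hK : ∀ t, ‖φ t‖ ≤ K) {z : ℂ} (hz : 0 < z.im) :
    Λ (laplace φ z) = laplace (fun t => Λ (φ t)) z := by
  simp only [laplace, map_smul, ← Λ.integral_comp_comm (integrableOn_exp_I_mul_smul hφ hK hz)]

theorem laplace_deriv {φ φ' : ℝ → X} (hφ : ∀ t, HasDerivAt φ (φ' t) t) (hφ' : Continuous φ')
    {K K' : ℝ} (hK : ∀ t, ‖φ t‖ ≤ K) (hK' : ∀ t, ‖φ' t‖ ≤ K') {z : ℂ} (hz : 0 < z.im) :
    laplace φ' z = -Complex.I • (φ 0 + z • laplace φ z) := by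
  have hcont : Continuous φ := continuous_iff_continuousAt.2 fun t => (hφ t).continuousAt
  have hint := integrableOn_exp_I_mul_smul hcont hK hz
  have hint' := integrableOn_exp_I_mul_smul hφ' hK' hz
  have hint_smul : IntegrableOn
      (fun t : ℝ => (Complex.I * z * Complex.exp (Complex.I * z * t)) • φ t) (Set.Ioi 0) := by
    simp only [mul_smul _ (Complex.exp _)]
    exact hint.smul (Complex.I * z)
  have hparts := integral_Ioi_of_hasDerivAt_of_tendsto'
    (fun t _ => (hasDerivAt_exp_I_mul z t).smul (hφ t)) (hint'.add hint_smul)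
    (tendsto_exp_I_mul_smul_atTop hK hz)
  rw [integral_add hint' hint_smul] at hparts
  simp only [mul_smul _ (Complex.exp _), integral_smul, Pi.smul_apply', Complex.ofReal_zero,
    mul_zero, Complex.exp_zero, one_smul, zero_sub] at hparts
  rw [laplace, eq_sub_of_add_eq hparts, laplace, mul_smul, smul_comm z]
  module

end Laplace

section Damped

open MeasureTheory

variable {X : Type*} [NormedAddCommGroup X]

theorem integrableOn_exp_mul_norm_sq {φ : ℝ → X} (hφ : Continuous φ) {K : ℝ} (hK : ∀ t, ‖φ t‖ ≤ K)
    {ε : ℝ} (hε : 0 < ε) :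
    IntegrableOn (fun t => Real.exp (-2 * ε * t) * ‖φ t‖ ^ 2) (Set.Ioi 0) := by
  have hexp := (exp_neg_integrableOn_Ioi 0 (show 0 < 2 * ε by positivity)).mul_const (K ^ 2)
  refine hexp.mono' (Continuous.aestronglyMeasurable (by fun_prop)) (.of_forall fun t => ?_)
  rw [Real.norm_of_nonneg (by positivity), neg_mul]
  gcongr
  exact hK t

variable [NormedSpace ℝ X]

/-- `φ` on the positive half-line, damped by `e^{-εt}` and extended by zero: the function whose
Fourier transform is the Laplace transform of `φ` along the line `Im z = ε`. -/
def damped (ε : ℝ) (φ : ℝ → X) : ℝ → X :=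
  (Set.Ioi 0).indicator fun t => Real.exp (-ε * t) • φ t

theorem norm_damped_sq (ε : ℝ) (φ : ℝ → X) (t : ℝ) :
    ‖damped ε φ t‖ ^ 2
      = (Set.Ioi 0).indicator (fun t => Real.exp (-2 * ε * t) * ‖φ t‖ ^ 2) t := by
  by_cases ht : t ∈ Set.Ioi (0 : ℝ)
  · rw [damped, Set.indicator_of_mem ht, Set.indicator_of_mem ht, norm_smul, mul_pow,
      Real.norm_eq_abs, Real.abs_exp, ← Real.exp_nat_mul]
    ring_nf
  · simp [damped, Set.indicator_of_notMem ht]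

theorem integrable_damped {φ : ℝ → X} (hφ : Continuous φ) {K : ℝ} (hK : ∀ t, ‖φ t‖ ≤ K)
    {ε : ℝ} (hε : 0 < ε) : Integrable (damped ε φ) := by
  rw [damped, integrable_indicator_iff measurableSet_Ioi]
  refine ((exp_neg_integrableOn_Ioi 0 hε).mul_const K).mono'
    (Continuous.aestronglyMeasurable (by fun_prop)) (.of_forall fun t => ?_)
  rw [norm_smul, Real.norm_eq_abs, Real.abs_exp]
  gcongr
  exact hK t

theorem memLp_two_damped {φ : ℝ → X} (hφ : Continuous φ) {K : ℝ} (hK : ∀ t, ‖φ t‖ ≤ K)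
    {ε : ℝ} (hε : 0 < ε) : MemLp (damped ε φ) 2 := by
  rw [memLp_two_iff_integrable_sq_norm (integrable_damped hφ hK hε).1]
  simp only [norm_damped_sq]
  exact (integrable_indicator_iff measurableSet_Ioi).2 (integrableOn_exp_mul_norm_sq hφ hK hε)

end Damped

section Plancherel

open MeasureTheory FourierTransform SchwartzMap

theorem integral_norm_sq_coeFn_Lp {α G : Type*} [MeasurableSpace α] {ν : Measure α}
    [NormedAddCommGroup G] (f : Lp G 2 ν) : ∫ x, ‖f x‖ ^ 2 ∂ν = ‖f‖ ^ 2 := by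
  have hnonneg : 0 ≤ ∫ x, ‖f x‖ ^ 2 ∂ν := integral_nonneg fun x => sq_nonneg _
  rw [Lp.norm_def, (Lp.memLp f).eLpNorm_eq_integral_rpow_norm two_ne_zero ENNReal.ofNat_ne_top,
    ENNReal.toReal_ofReal (by positivity), ENNReal.toReal_ofNat, ← Real.rpow_natCast,
    ← Real.rpow_mul (by simpa using hnonneg)]
  norm_num

variable {V F : Type*} [NormedAddCommGroup V] [InnerProductSpace ℝ V] [FiniteDimensional ℝ V]
  [MeasurableSpace V] [BorelSpace V] [NormedAddCommGroup F] [InnerProductSpace ℂ F]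

theorem laplace_eq_fourier_damped (ε E : ℝ) (φ : ℝ → F) :
    laplace φ (E + ε * Complex.I) = Complex.I • 𝓕 (damped ε φ) (E * -(2 * Real.pi)⁻¹) := by
  rw [laplace, Real.fourier_eq', ← integral_indicator measurableSet_Ioi]
  congr 2 with t
  by_cases ht : t ∈ Set.Ioi (0 : ℝ)
  · simp only [damped, Set.indicator_of_mem ht]
    rw [RCLike.real_smul_eq_coe_smul (K := ℂ), smul_smul, RCLike.ofReal_eq_complex_ofReal,
      Complex.ofReal_exp, ← Complex.exp_add]
    congr 2
    have hpi : (Real.pi : ℂ) ≠ 0 := by exact_mod_cast Real.pi_ne_zero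
    simp only [RCLike.inner_apply, conj_trivial]
    push_cast
    field_simp
    linear_combination (t * ε : ℂ) * Complex.I_sq
  · simp only [damped, Set.indicator_of_notMem ht, smul_zero]

variable [CompleteSpace F]

theorem integral_smul_fourier_toLp {f : V → F} (hf : Integrable f) (hf2 : MemLp f 2)
    (g : 𝓢(V, ℂ)) :
    ∫ x, g x • (𝓕 (hf2.toLp f) : Lp F 2 (volume : Measure V)) x = ∫ x, g x • 𝓕 f x := by
  have hdistr := DFunLike.congr_fun (Lp.fourier_toTemperedDistribution_eq (hf2.toLp f)) g
  rw [TemperedDistribution.fourier_apply, Lp.toTemperedDistribution_apply,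
    Lp.toTemperedDistribution_apply] at hdistr
  have hflip : ∫ x, g x • 𝓕 f x = ∫ x, 𝓕 g x • f x := by
    simpa using! (VectorFourier.integral_fourierIntegral_smul_eq_flip (L := innerₗ V)
      Real.continuous_fourierChar continuous_inner g.integrable hf).symm
  rw [← hdistr, hflip]
  refine integral_congr_ae ?_
  filter_upwards [hf2.coeFn_toLp] with x hx using by rw [hx]

theorem coeFn_fourier_toLp_ae_eq {f : V → F} (hf : Integrable f) (hf2 : MemLp f 2) :
    (𝓕 (hf2.toLp f) : Lp F 2 (volume : Measure V)) =ᵐ[volume] 𝓕 f := by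
  have hcont : Continuous (𝓕 f) := VectorFourier.fourierIntegral_continuous
    Real.continuous_fourierChar (by exact continuous_inner) hf
  refine ae_eq_of_integral_contDiff_smul_eq
    ((Lp.memLp _).locallyIntegrable (by norm_num)) hcont.locallyIntegrable fun g hg hgs => ?_
  have hgs' : HasCompactSupport fun x => (g x : ℂ) := hgs.comp_left (g := Complex.ofReal) rfl
  have hg' : ContDiff ℝ (⊤ : ℕ∞) fun x => (g x : ℂ) := Complex.ofRealCLM.contDiff.comp hg
  simpa using integral_smul_fourier_toLp hf hf2 (hgs'.toSchwartzMap hg')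

theorem integrable_norm_fourier_sq {f : V → F} (hf : Integrable f) (hf2 : MemLp f 2) :
    Integrable fun x => ‖𝓕 f x‖ ^ 2 := by
  have hLp := Lp.memLp (𝓕 (hf2.toLp f) : Lp F 2 (volume : Measure V))
  exact (hLp.ae_eq (coeFn_fourier_toLp_ae_eq hf hf2)).integrable_norm_pow two_ne_zero

theorem integral_norm_fourier_sq {f : V → F} (hf : Integrable f) (hf2 : MemLp f 2) :
    ∫ x, ‖𝓕 f x‖ ^ 2 = ∫ x, ‖f x‖ ^ 2 := calc
  ∫ x, ‖𝓕 f x‖ ^ 2 = ∫ x, ‖(𝓕 (hf2.toLp f) : Lp F 2 (volume : Measure V)) x‖ ^ 2 := by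
    refine integral_congr_ae ?_
    filter_upwards [coeFn_fourier_toLp_ae_eq hf hf2] with x hx using by rw [hx]
  _ = ∫ x, ‖hf2.toLp f x‖ ^ 2 := by
    rw [integral_norm_sq_coeFn_Lp, integral_norm_sq_coeFn_Lp, Lp.norm_fourier_eq]
  _ = ∫ x, ‖f x‖ ^ 2 := by
    refine integral_congr_ae ?_
    filter_upwards [hf2.coeFn_toLp] with x hx using by rw [hx]

theorem integrable_norm_laplace_sq {φ : ℝ → F} (hφ : Continuous φ) {K : ℝ} (hK : ∀ t, ‖φ t‖ ≤ K)
    {ε : ℝ} (hε : 0 < ε) :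
    Integrable fun E : ℝ => ‖laplace φ (E + ε * Complex.I)‖ ^ 2 := by
  simp only [laplace_eq_fourier_damped, norm_smul, Complex.norm_I, one_mul]
  exact (integrable_norm_fourier_sq (integrable_damped hφ hK hε)
    (memLp_two_damped hφ hK hε)).comp_mul_right' (by simp [Real.pi_ne_zero])

theorem integral_norm_laplace_sq {φ : ℝ → F} (hφ : Continuous φ) {K : ℝ} (hK : ∀ t, ‖φ t‖ ≤ K)
    {ε : ℝ} (hε : 0 < ε) :
    ∫ E : ℝ, ‖laplace φ (E + ε * Complex.I)‖ ^ 2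
      = 2 * Real.pi * ∫ t in Set.Ioi (0 : ℝ), Real.exp (-2 * ε * t) * ‖φ t‖ ^ 2 := by
  simp only [laplace_eq_fourier_damped, norm_smul, Complex.norm_I, one_mul]
  rw [Measure.integral_comp_mul_right (fun x => ‖𝓕 (damped ε φ) x‖ ^ 2),
    integral_norm_fourier_sq (integrable_damped hφ hK hε) (memLp_two_damped hφ hK hε)]
  simp only [norm_damped_sq]
  rw [integral_indicator measurableSet_Ioi, inv_neg, inv_inv, abs_neg,
    abs_of_pos Real.two_pi_pos, smul_eq_mul]

end Plancherel

/-! ### The evolution and the resolvent -/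

section Evolution

/-- The continuous functional `u ↦ (H u)(n)`, defined on all of `ℓ²(ℤ)`. -/
def jacobiFunctional (a b : ℤ → ℝ) (n : ℤ) : ℓ²(ℤ, ℂ) →L[ℂ] ℂ :=
  (a n : ℂ) • lp.evalCLM ℂ (fun _ : ℤ => ℂ) 2 (n + 1)
    + (a (n - 1) : ℂ) • lp.evalCLM ℂ (fun _ : ℤ => ℂ) 2 (n - 1)
    + (b n : ℂ) • lp.evalCLM ℂ (fun _ : ℤ => ℂ) 2 n

variable {a b : ℤ → ℝ} {ψ : ℝ → ℓ²(ℤ, ℂ)} {ψ₀ : ℓ²(ℤ, ℂ)}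

theorem IsEvolution.continuous (hψ : IsEvolution (jacobiOperator a b) ψ₀ ψ) : Continuous ψ :=
  continuous_iff_continuousAt.2 fun t =>
    let ⟨_, _, hd⟩ := hψ.2 t
    hd.continuousAt

theorem IsEvolution.continuous_apply (hψ : IsEvolution (jacobiOperator a b) ψ₀ ψ) (n : ℤ) :
    Continuous fun t => ψ t n :=
  (lp.evalCLM ℂ (fun _ : ℤ => ℂ) 2 n).continuous.comp hψ.continuous

theorem IsEvolution.hasDerivAt_apply (hψ : IsEvolution (jacobiOperator a b) ψ₀ ψ) (n : ℤ)
    (t : ℝ) : HasDerivAt (fun t => ψ t n) (-Complex.I * jacobiExpr a b (ψ t) n) t := by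
  obtain ⟨v, hv, hd⟩ := hψ.2 t
  rw [← hv]
  exact ((lp.evalCLM ℂ (fun _ : ℤ => ℂ) 2 n).restrictScalars ℝ).hasFDerivAt.comp_hasDerivAt t hd

theorem IsEvolution.norm_eq (ha : IsJacobiData a) (hψ : IsEvolution (jacobiOperator a b) ψ₀ ψ)
    (t : ℝ) : ‖ψ t‖ = ‖ψ₀‖ := by
  have hderiv (t : ℝ) : HasDerivAt (fun s => inner ℂ (ψ s) (ψ s)) 0 t := by
    obtain ⟨v, hv, hd⟩ := hψ.2 t
    refine (hd.inner ℂ hd).congr_deriv ?_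
    rw [← hv, inner_smul_right, inner_smul_left, ← inner_conj_symm (jacobiOperator a b v),
      Complex.conj_eq_iff_im.2 (ha.im_inner_jacobiOperator v)]
    simp
  have hconst := is_const_of_deriv_eq_zero (fun t => (hderiv t).differentiableAt)
    (fun t => (hderiv t).deriv) t 0
  simp only [hψ.1, inner_self_eq_norm_sq_to_K] at hconst
  exact (pow_left_inj₀ (norm_nonneg _) (norm_nonneg _) two_ne_zero).1 (by exact_mod_cast hconst)

theorem IsEvolution.norm_apply_le (ha : IsJacobiData a)
    (hψ : IsEvolution (jacobiOperator a b) ψ₀ ψ) (n : ℤ) (t : ℝ) : ‖ψ t n‖ ≤ ‖ψ₀‖ :=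
  (lp.norm_apply_le_norm two_ne_zero (ψ t) n).trans_eq (hψ.norm_eq ha t)

theorem IsEvolution.laplace_apply (ha : IsJacobiData a)
    (hψ : IsEvolution (jacobiOperator a b) ψ₀ ψ) {z : ℂ} (hz : 0 < z.im) (n : ℤ) :
    laplace ψ z n = laplace (fun t => ψ t n) z :=
  map_laplace (lp.evalCLM ℂ (fun _ : ℤ => ℂ) 2 n) hψ.continuous (fun t => (hψ.norm_eq ha t).le) hz

theorem IsEvolution.jacobiExpr_laplace (ha : IsJacobiData a)
    (hψ : IsEvolution (jacobiOperator a b) ψ₀ ψ) {z : ℂ} (hz : 0 < z.im) (n : ℤ) :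
    jacobiExpr a b ⇑(laplace ψ z) n = ψ₀ n + z * laplace ψ z n := by
  set Λ := jacobiFunctional a b n
  have hΛ : Continuous fun t => Λ (ψ t) := Λ.continuous.comp hψ.continuous
  have hbound (t : ℝ) : ‖-Complex.I • Λ (ψ t)‖ ≤ ‖Λ‖ * ‖ψ₀‖ := by
    rw [norm_smul, norm_neg, Complex.norm_I, one_mul, ← hψ.norm_eq ha t]
    exact Λ.le_opNorm _
  have hderiv := laplace_deriv (hψ.hasDerivAt_apply n) (hΛ.const_smul (-Complex.I))
    (hψ.norm_apply_le ha n) hbound hz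
  rw [← hψ.laplace_apply ha hz, hψ.1] at hderiv
  refine smul_right_injective ℂ (neg_ne_zero.2 Complex.I_ne_zero) ?_
  calc -Complex.I • Λ (laplace ψ z) = laplace (fun t => -Complex.I • Λ (ψ t)) z := by
        rw [map_laplace Λ hψ.continuous (fun t => (hψ.norm_eq ha t).le) hz, laplace_const_smul]
    _ = -Complex.I • (ψ₀ n + z • laplace ψ z n) := hderiv

theorem IsEvolution.exists_jacobiOperator_laplace (ha : IsJacobiData a)
    (hψ : IsEvolution (jacobiOperator a b) ψ₀ ψ) {z : ℂ} (hz : 0 < z.im) :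
    ∃ g : (jacobiOperator a b).domain, (g : ℓ²(ℤ, ℂ)) = laplace ψ z ∧
      jacobiOperator a b g = ψ₀ + z • (g : ℓ²(ℤ, ℂ)) := by
  have hexpr : jacobiExpr a b ⇑(laplace ψ z) = ⇑(ψ₀ + z • laplace ψ z) :=
    funext (hψ.jacobiExpr_laplace ha hz)
  have hmem : Memℓp (jacobiExpr a b ⇑(laplace ψ z)) 2 := hexpr ▸ lp.memℓp _
  exact ⟨⟨laplace ψ z, hmem⟩, rfl, Subtype.ext hexpr⟩

/-- The Borel transform `∫ dμ(x) / (x - z)`. -/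
def borelTransform (μ : MeasureTheory.Measure ℝ) (z : ℂ) : ℂ :=
  ∫ x : ℝ, ((x : ℂ) - z)⁻¹ ∂μ

theorem IsEvolution.inner_laplace (ha : IsJacobiData a)
    (hψ : IsEvolution (jacobiOperator a b) ψ₀ ψ) {μ : MeasureTheory.Measure ℝ}
    (hμ : IsSpectralMeasure (jacobiOperator a b) ψ₀ μ) {z : ℂ} (hz : 0 < z.im) :
    inner ℂ ψ₀ (laplace ψ z) = borelTransform μ z := by
  obtain ⟨g, hg, hgμ⟩ := hμ.2 z hz.ne'
  obtain ⟨h, hh, hH⟩ := hψ.exists_jacobiOperator_laplace ha hz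
  have hzero := ha.eq_zero_of_jacobiOperator_eq_smul hz.ne' (g - h) (by
    rw [LinearPMap.map_sub, hH, sub_eq_iff_eq_add.1 hg, Submodule.coe_sub, smul_sub,
      add_sub_add_left_eq_sub])
  rw [Submodule.coe_sub, sub_eq_zero] at hzero
  rw [borelTransform, ← hgμ, hzero, hh]

theorem delta1_apply (n : ℤ) : delta1 n = if n = 1 then 1 else 0 := by
  simp [delta1, Pi.single_apply]

theorem inner_delta1_left (u : ℓ²(ℤ, ℂ)) : inner ℂ delta1 u = u 1 := by
  simp [delta1, lp.inner_single_left]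

end Evolution

/-! ### From resolvent bounds near a set to its measure -/

section Thickening

open MeasureTheory Metric

variable {X : Type*} [PseudoMetricSpace X] [SecondCountableTopology X] [MeasurableSpace X]
  [BorelSpace X] (μ ν : Measure X) [SFinite μ] [SFinite ν]

theorem lintegral_measure_ball_comm (ε : ℝ) :
    ∫⁻ y, μ (ball y ε) ∂ν = ∫⁻ x, ν (ball x ε) ∂μ := by
  have hmeas : MeasurableSet {p : X × X | dist p.1 p.2 < ε} :=
    (isOpen_lt continuous_dist continuous_const).measurableSet
  have hslice (y : X) : Prod.mk y ⁻¹' {p : X × X | dist p.1 p.2 < ε} = ball y ε :=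
    Set.ext fun _ => mem_ball'.symm
  have hswap := (Measure.prod_apply (μ := ν) (ν := μ) hmeas).symm.trans
    (Measure.prod_apply_symm hmeas)
  simp only [hslice] at hswap
  exact hswap

theorem mul_measure_le_lintegral_thickening {ε : ℝ} {c : ENNReal} (hc : ∀ x, c ≤ ν (ball x ε))
    (S : Set X) : c * μ S ≤ ∫⁻ y in thickening ε S, μ (ball y ε) ∂ν := by
  have hsub {x : X} (hx : x ∈ closure S) : ball x ε ⊆ thickening ε S := by
    rw [← thickening_closure]
    exact ball_subset_thickening hx ε
  calc c * μ S ≤ c * μ (closure S) := by gcongr; exact subset_closure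
    _ = ∫⁻ _ in closure S, c ∂μ := (setLIntegral_const _ _).symm
    _ ≤ ∫⁻ x in closure S, ν.restrict (thickening ε S) (ball x ε) ∂μ :=
        setLIntegral_mono' isClosed_closure.measurableSet fun x hx => by
          rw [Measure.restrict_eq_self _ (hsub hx)]
          exact hc x
    _ ≤ ∫⁻ x, ν.restrict (thickening ε S) (ball x ε) ∂μ := setLIntegral_le_lintegral _ _
    _ = ∫⁻ y in thickening ε S, μ (ball y ε) ∂ν := (lintegral_measure_ball_comm _ _ ε).symm

variable {μ ν}

theorem mul_measureReal_le_integral [IsFiniteMeasure μ] {ε c : ℝ} (hc : 0 ≤ c)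
    (hν : ∀ x, ENNReal.ofReal c ≤ ν (ball x ε)) {S : Set X} {g : X → ℝ} (hg : Integrable g ν)
    (hg0 : 0 ≤ g) (hball : ∀ y ∈ thickening ε S, μ.real (ball y ε) ≤ g y) :
    c * μ.real S ≤ ∫ y, g y ∂ν := by
  rw [← ENNReal.ofReal_le_ofReal_iff (integral_nonneg hg0), ENNReal.ofReal_mul hc,
    ofReal_measureReal, ofReal_integral_eq_lintegral_ofReal hg (.of_forall hg0)]
  refine (mul_measure_le_lintegral_thickening μ ν hν S).trans
    (le_trans ?_ (setLIntegral_le_lintegral (thickening ε S) _))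
  refine setLIntegral_mono' isOpen_thickening.measurableSet fun y hy => ?_
  rw [← ofReal_measureReal]
  exact ENNReal.ofReal_le_ofReal (hball y hy)

end Thickening

section BorelTransform

open MeasureTheory Metric

variable (μ : Measure ℝ) [IsFiniteMeasure μ]

theorem integrable_inv_sub {z : ℂ} (hz : z.im ≠ 0) :
    Integrable (fun x : ℝ => ((x : ℂ) - z)⁻¹) μ := by
  have him (x : ℝ) : |z.im| ≤ ‖(x : ℂ) - z‖ := by simpa using Complex.abs_im_le_norm ((x : ℂ) - z)
  have hne (x : ℝ) : (x : ℂ) - z ≠ 0 := norm_pos_iff.1 ((abs_pos.2 hz).trans_le (him x))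
  refine Integrable.of_bound (C := |z.im|⁻¹)
    (Continuous.aestronglyMeasurable (.inv₀ (by fun_prop) hne)) (.of_forall fun x => ?_)
  rw [norm_inv]
  exact inv_anti₀ (abs_pos.2 hz) (him x)

theorem measureReal_ball_le_borelTransform_im (E : ℝ) {ε : ℝ} (hε : 0 < ε) :
    (2 * ε)⁻¹ * μ.real (ball E ε) ≤ (borelTransform μ (E + ε * Complex.I)).im := by
  set z : ℂ := E + ε * Complex.I
  have hint := integrable_inv_sub μ (z := z) (by simpa [z] using hε.ne')
  have him (x : ℝ) : (((x : ℂ) - z)⁻¹).im = ε / ((x - E) ^ 2 + ε ^ 2) := by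
    simp [z, Complex.inv_im, Complex.normSq_apply]
    ring
  have hint_im : Integrable (fun x : ℝ => ε / ((x - E) ^ 2 + ε ^ 2)) μ := by
    simpa only [Complex.imCLM_apply, him] using Complex.imCLM.integrable_comp hint
  have hkernel {x : ℝ} (hx : x ∈ ball E ε) : (2 * ε)⁻¹ ≤ ε / ((x - E) ^ 2 + ε ^ 2) := by
    rw [mem_ball, Real.dist_eq, ← abs_of_pos hε] at hx
    have hsq : (x - E) ^ 2 ≤ ε ^ 2 := (sq_lt_sq.2 hx).le
    rw [inv_eq_one_div, div_le_div_iff₀ (by positivity) (by positivity)]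
    nlinarith
  calc (2 * ε)⁻¹ * μ.real (ball E ε) = ∫ _ in ball E ε, (2 * ε)⁻¹ ∂μ := by
        rw [setIntegral_const, smul_eq_mul, mul_comm]
    _ ≤ ∫ x in ball E ε, ε / ((x - E) ^ 2 + ε ^ 2) ∂μ :=
        setIntegral_mono_on integrableOn_const hint_im.integrableOn isOpen_ball.measurableSet
          fun x hx => hkernel hx
    _ ≤ ∫ x, ε / ((x - E) ^ 2 + ε ^ 2) ∂μ :=
        setIntegral_le_integral hint_im (.of_forall fun x => by positivity)
    _ = (borelTransform μ z).im := by
        simp only [← him]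
        exact Complex.imCLM.integral_comp_comm hint

end BorelTransform

/-! ### The resolvent vector on the half-lines -/

section Resolvent

/-- The right half of a vector `u` with `(H - z) u = δ₁`. Its boundary value is `a(0) u(0) - 1`
instead of `u(0)`; this absorbs the source and the coupling `a(0)`, and leaves the homogeneous
equation with coefficients `normalized a`. -/
def rightResolvent (a : ℤ → ℝ) (u : ℤ → ℂ) : ℕ → ℂ :=
  Function.update (rightHalf u) 0 (a 0 * u 0 - 1)

/-- The reflected left half of a vector `u` with `(H - z) u = δ₁`. Its boundary value is
`a(0) u(1)` instead of `u(1)`, to absorb the coupling `a(0)`. -/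
def leftResolvent (a : ℤ → ℝ) (u : ℤ → ℂ) : ℕ → ℂ :=
  Function.update (leftHalf u) 0 (a 0 * u 1)

theorem rightResolvent_zero (a : ℤ → ℝ) (u : ℤ → ℂ) : rightResolvent a u 0 = a 0 * u 0 - 1 :=
  Function.update_self ..

theorem rightResolvent_succ (a : ℤ → ℝ) (u : ℤ → ℂ) (n : ℕ) :
    rightResolvent a u (n + 1) = rightHalf u (n + 1) :=
  Function.update_of_ne n.succ_ne_zero ..

theorem leftResolvent_zero (a : ℤ → ℝ) (u : ℤ → ℂ) : leftResolvent a u 0 = a 0 * u 1 :=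
  Function.update_self ..

theorem leftResolvent_succ (a : ℤ → ℝ) (u : ℤ → ℂ) (n : ℕ) :
    leftResolvent a u (n + 1) = leftHalf u (n + 1) :=
  Function.update_of_ne n.succ_ne_zero ..

theorem normalized_mul_rightResolvent (a : ℤ → ℝ) (u : ℤ → ℂ) (n : ℕ) :
    normalized a n * rightResolvent a u n = a n * u n - delta1 (n + 1) := by
  rcases n with _ | n
  · simp [rightResolvent_zero, normalized_zero, delta1_apply]
  · rw [rightResolvent_succ, normalized_of_ne a (by omega), delta1_apply, if_neg (by omega),
      sub_zero, rightHalf]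

theorem normalized_mul_leftResolvent (a : ℤ → ℝ) (u : ℤ → ℂ) (n : ℕ) :
    normalized a (-n) * leftResolvent a u n = a (-n) * u (1 - n) := by
  rcases n with _ | n
  · simp [leftResolvent_zero, normalized_zero]
  · rw [leftResolvent_succ, normalized_of_ne a (by omega), leftHalf]

variable {a b : ℤ → ℝ} {u : ℤ → ℂ} {z : ℂ}

theorem isSolution_rightResolvent (hu : ∀ n, jacobiExpr a b u n = delta1 n + z * u n) :
    IsSolution (fun n => ((rightHalf (normalized a) n : ℝ) : ℂ))
      (fun n => ((rightHalf b n : ℝ) : ℂ)) z (rightResolvent a u) := fun n => by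
  have h := hu (n + 1)
  have hbond := normalized_mul_rightResolvent a u n
  have hnorm : normalized a (n + 1) = a (n + 1) := normalized_of_ne a (by omega)
  rw [jacobiExpr, add_sub_cancel_right] at h
  simp only [rightResolvent_succ, rightHalf, Nat.cast_add, Nat.cast_one, hnorm]
  linear_combination h + hbond

theorem isSolution_leftResolvent (hu : ∀ n, jacobiExpr a b u n = delta1 n + z * u n) :
    IsSolution (fun n : ℕ => (normalized a (-n) : ℂ)) (fun n => ((leftHalf b n : ℝ) : ℂ)) z
      (leftResolvent a u) := fun n => by
  have h := hu (-n)
  have hbond := normalized_mul_leftResolvent a u n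
  have hnorm : normalized a (-n - 1) = a (-n - 1) := normalized_of_ne a (by omega)
  rw [jacobiExpr, delta1_apply, if_neg (by omega), neg_add_eq_sub] at h
  simp only [leftResolvent_succ, leftHalf, Nat.cast_add, Nat.cast_one]
  rw [show 1 - ((n : ℤ) + 1 + 1) = -n - 1 by ring, show 1 - ((n : ℤ) + 1) = -n by ring,
    neg_add', hnorm]
  linear_combination h + hbond

theorem neg_im_eq_im_rightResolvent_add_im_leftResolvent (a : ℤ → ℝ) (u : ℤ → ℂ) :
    -(u 1).im = ((starRingEnd ℂ) (rightResolvent a u 0) * rightResolvent a u 1).im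
      + ((starRingEnd ℂ) (leftResolvent a u 0) * leftResolvent a u 1).im := by
  simp [rightResolvent_zero, leftResolvent_zero, rightResolvent_succ, leftResolvent_succ,
    rightHalf, leftHalf]
  ring

theorem mul_abs_im_le_boxNormSq (ha : ∀ n, a n ≠ 0)
    (hu : ∀ n, jacobiExpr a b u n = delta1 n + z * u n) {E ε L₁ L₂ : ℝ} (hε : 0 < ε)
    (hz : ‖z - E‖ ^ 2 ≤ 2 * ε ^ 2) (hL₁ : 0 ≤ L₁) (hL₂ : 0 ≤ L₂)
    (hleft : ε⁻¹ ≤ √(leftGram a b E (L₁ + 1))) (hright : ε⁻¹ ≤ √(rightGram a b E L₂)) :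
    2 / 15 * ε⁻¹ * |(u 1).im| ≤ boxNormSq u L₁ L₂ := by
  have hR := (isFundamentalPair_right ha b E).mul_abs_im_le (isSolution_rightResolvent hu) hε hz
    hright
  have hL := (isFundamentalPair_left ha b E).mul_abs_im_le (isSolution_leftResolvent hu) hε hz
    hleft
  set xR := ((starRingEnd ℂ) (rightResolvent a u 0) * rightResolvent a u 1).im
  set xL := ((starRingEnd ℂ) (leftResolvent a u 0) * leftResolvent a u 1).im
  have hRu : partialSum L₂ (fun k => ‖rightResolvent a u k‖ ^ 2)
      ≤ partialSum L₂ fun k => ‖rightHalf u k‖ ^ 2 :=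
    partialSum_le_partialSum fun k _ => by rw [rightResolvent_succ]
  have hLu : partialSum (L₁ + 1) (fun k => ‖leftResolvent a u k‖ ^ 2)
      ≤ partialSum (L₁ + 1) fun k => ‖leftHalf u k‖ ^ 2 :=
    partialSum_le_partialSum fun k _ => by rw [leftResolvent_succ]
  have him : |(u 1).im| ≤ |xR| + |xL| := by
    rw [← abs_neg, neg_im_eq_im_rightResolvent_add_im_leftResolvent a u]
    exact abs_add_le xR xL
  rw [boxNormSq_eq_partialSum_add u hL₁ hL₂]
  calc 2 / 15 * ε⁻¹ * |(u 1).im| ≤ 2 / 15 * ε⁻¹ * (|xR| + |xL|) := by gcongr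
    _ = 2 / 15 * ε⁻¹ * |xL| + 2 / 15 * ε⁻¹ * |xR| := by ring
    _ ≤ _ := add_le_add (by simpa [normalized_zero] using hL.trans hLu)
        (by simpa [normalized_zero, rightHalf] using hR.trans hRu)

end Resolvent

/-! ### Time averages and energy averages -/

section Box

open MeasureTheory

/-- The sum over the sites of `[-L₁, L₂]`, interpolated linearly in `L₁` and `L₂`, so that
`‖φ‖²_{L₁,L₂}` is the value at `|φ|²`. -/
def boxSum (L₁ L₂ : ℝ) : (ℤ → ℝ) →ₗ[ℝ] ℝ :=
  partialSum (L₁ + 1) ∘ₗ LinearMap.funLeft ℝ ℝ (fun n : ℕ => 1 - (n : ℤ))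
    + partialSum L₂ ∘ₗ LinearMap.funLeft ℝ ℝ ((↑) : ℕ → ℤ)

variable {L₁ L₂ : ℝ}

theorem boxSum_apply (L₁ L₂ : ℝ) (c : ℤ → ℝ) :
    boxSum L₁ L₂ c = partialSum (L₁ + 1) (leftHalf c) + partialSum L₂ (rightHalf c) := rfl

theorem boxNormSq_eq_boxSum (φ : ℤ → ℂ) (hL₁ : 0 ≤ L₁) (hL₂ : 0 ≤ L₂) :
    boxNormSq φ L₁ L₂ = boxSum L₁ L₂ fun n => ‖φ n‖ ^ 2 :=
  boxNormSq_eq_partialSum_add φ hL₁ hL₂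

theorem boxNormSq_nonneg (φ : ℤ → ℂ) (hL₁ : 0 ≤ L₁) (hL₂ : 0 ≤ L₂) : 0 ≤ boxNormSq φ L₁ L₂ := by
  rw [boxNormSq_eq_partialSum_add φ hL₁ hL₂]
  exact add_nonneg (partialSum_nonneg _ fun n => sq_nonneg _)
    (partialSum_nonneg _ fun n => sq_nonneg _)

theorem apply_one_le_boxSum (L₁ : ℝ) (hL₂ : 1 ≤ L₂) {c : ℤ → ℝ} (hc : 0 ≤ c) :
    c 1 ≤ boxSum L₁ L₂ c := by
  have hright := sum_range_le_partialSum (n := 1) (c := rightHalf c) (mod_cast hL₂) fun n => hc n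
  have hleft := partialSum_nonneg (c := leftHalf c) (L₁ + 1) fun n => hc (1 - n)
  rw [boxSum_apply]
  simp [rightHalf] at hright
  linarith

variable {X : Type*} [MeasurableSpace X] {ν : Measure X}

theorem integrable_partialSum {f : X → ℕ → ℝ} (hf : ∀ n, Integrable (fun x => f x n) ν) (s : ℝ) :
    Integrable (fun x => partialSum s (f x)) ν := by
  simp only [partialSum_apply]
  exact integrable_finsetSum _ fun n _ => (hf (n + 1)).const_mul _

theorem integral_partialSum {f : X → ℕ → ℝ} (hf : ∀ n, Integrable (fun x => f x n) ν) (s : ℝ) :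
    ∫ x, partialSum s (f x) ∂ν = partialSum s fun n => ∫ x, f x n ∂ν := by
  simp only [partialSum_apply]
  rw [integral_finsetSum _ fun n _ => (hf (n + 1)).const_mul _]
  simp only [integral_const_mul]

theorem integrable_boxSum {f : X → ℤ → ℝ} (hf : ∀ n, Integrable (fun x => f x n) ν) (L₁ L₂ : ℝ) :
    Integrable (fun x => boxSum L₁ L₂ (f x)) ν :=
  (integrable_partialSum (fun n => hf (1 - n)) (L₁ + 1)).add
    (integrable_partialSum (fun n => hf n) L₂)

theorem integral_boxSum {f : X → ℤ → ℝ} (hf : ∀ n, Integrable (fun x => f x n) ν) (L₁ L₂ : ℝ) :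
    ∫ x, boxSum L₁ L₂ (f x) ∂ν = boxSum L₁ L₂ fun n => ∫ x, f x n ∂ν := by
  have hleft (n : ℕ) : Integrable (fun x => leftHalf (f x) n) ν := hf (1 - n)
  have hright (n : ℕ) : Integrable (fun x => rightHalf (f x) n) ν := hf n
  simp only [boxSum_apply]
  rw [integral_add (integrable_partialSum hleft _) (integrable_partialSum hright _),
    integral_partialSum hleft, integral_partialSum hright]
  rfl

end Box

section Average

open MeasureTheory

variable {a b : ℤ → ℝ} {ψ : ℝ → ℓ²(ℤ, ℂ)} {ψ₀ : ℓ²(ℤ, ℂ)} {ε T L₁ L₂ : ℝ}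

theorem integral_exp_mul_norm_sq_pos {F : Type*} [NormedAddCommGroup F] {φ : ℝ → F}
    (hφ : Continuous φ) {K : ℝ} (hK : ∀ t, ‖φ t‖ ≤ K) (hε : 0 < ε) (h0 : φ 0 ≠ 0) :
    0 < ∫ t in Set.Ioi (0 : ℝ), Real.exp (-2 * ε * t) * ‖φ t‖ ^ 2 := by
  rw [setIntegral_pos_iff_support_of_nonneg_ae (.of_forall fun t => by positivity)
    (integrableOn_exp_mul_norm_sq hφ hK hε)]
  obtain ⟨δ, hδ, hball⟩ := Metric.eventually_nhds_iff.1 (hφ.continuousAt.eventually_ne h0)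
  have hsub : Set.Ioo 0 δ ⊆ Function.support (fun t => Real.exp (-2 * ε * t) * ‖φ t‖ ^ 2)
      ∩ Set.Ioi 0 := fun t ht => by
    have hφt : φ t ≠ 0 := hball (by rw [Real.dist_0_eq_abs, abs_of_pos ht.1]; exact ht.2)
    exact ⟨mul_ne_zero (Real.exp_ne_zero _) (pow_ne_zero 2 (norm_ne_zero_iff.2 hφt)), ht.1⟩
  refine lt_of_lt_of_le ?_ (measure_mono hsub)
  simpa using hδ

theorem timeAverage_eq (T : ℝ) (A : ℝ → ℝ) :
    timeAverage T A = 2 / T * ∫ t in Set.Ioi (0 : ℝ), Real.exp (-2 * T⁻¹ * t) * A t := by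
  simp only [timeAverage, div_eq_mul_inv, mul_right_comm]

theorem IsEvolution.timeAverage_boxNormSq (ha : IsJacobiData a)
    (hψ : IsEvolution (jacobiOperator a b) ψ₀ ψ) (hT : 0 < T) (hL₁ : 0 ≤ L₁) (hL₂ : 0 ≤ L₂) :
    timeAverage T (fun t => boxNormSq (ψ t) L₁ L₂) = 2 / T * boxSum L₁ L₂
      fun n => ∫ t in Set.Ioi (0 : ℝ), Real.exp (-2 * T⁻¹ * t) * ‖ψ t n‖ ^ 2 := by
  rw [timeAverage_eq, ← integral_boxSum fun n => integrableOn_exp_mul_norm_sq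
    (hψ.continuous_apply n) (hψ.norm_apply_le ha n) (inv_pos.2 hT)]
  simp only [boxNormSq_eq_boxSum _ hL₁ hL₂, ← smul_eq_mul, ← map_smul]
  rfl

theorem IsEvolution.timeAverage_boxNormSq_pos (ha : IsJacobiData a)
    (hψ : IsEvolution (jacobiOperator a b) ψ₀ ψ) (hψ₀ : ψ₀ 1 ≠ 0) (hT : 0 < T) (hL₁ : 0 ≤ L₁)
    (hL₂ : 1 ≤ L₂) : 0 < timeAverage T (fun t => boxNormSq (ψ t) L₁ L₂) := by
  rw [hψ.timeAverage_boxNormSq ha hT hL₁ (zero_le_one.trans hL₂)]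
  refine mul_pos (by positivity) (lt_of_lt_of_le ?_ (apply_one_le_boxSum L₁ hL₂ fun n =>
    integral_nonneg fun t => by positivity))
  exact integral_exp_mul_norm_sq_pos (hψ.continuous_apply 1) (hψ.norm_apply_le ha 1)
    (inv_pos.2 hT) (by rwa [hψ.1])

theorem IsEvolution.integrable_norm_laplace_apply_sq (ha : IsJacobiData a)
    (hψ : IsEvolution (jacobiOperator a b) ψ₀ ψ) (hε : 0 < ε) (n : ℤ) :
    Integrable fun E : ℝ => ‖laplace ψ (E + ε * Complex.I) n‖ ^ 2 := by
  have happly (E : ℝ) := hψ.laplace_apply ha (z := E + ε * Complex.I) (by simpa using hε) n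
  simp only [happly]
  exact integrable_norm_laplace_sq (hψ.continuous_apply n) (hψ.norm_apply_le ha n) hε

theorem IsEvolution.integral_norm_laplace_apply_sq (ha : IsJacobiData a)
    (hψ : IsEvolution (jacobiOperator a b) ψ₀ ψ) (hε : 0 < ε) (n : ℤ) :
    ∫ E : ℝ, ‖laplace ψ (E + ε * Complex.I) n‖ ^ 2
      = 2 * Real.pi * ∫ t in Set.Ioi (0 : ℝ), Real.exp (-2 * ε * t) * ‖ψ t n‖ ^ 2 := by
  have happly (E : ℝ) := hψ.laplace_apply ha (z := E + ε * Complex.I) (by simpa using hε) n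
  simp only [happly]
  exact integral_norm_laplace_sq (hψ.continuous_apply n) (hψ.norm_apply_le ha n) hε

theorem IsEvolution.integrable_boxNormSq_laplace (ha : IsJacobiData a)
    (hψ : IsEvolution (jacobiOperator a b) ψ₀ ψ) (hε : 0 < ε) (hL₁ : 0 ≤ L₁) (hL₂ : 0 ≤ L₂) :
    Integrable fun E : ℝ => boxNormSq ⇑(laplace ψ (E + ε * Complex.I)) L₁ L₂ := by
  simp only [boxNormSq_eq_boxSum _ hL₁ hL₂]
  exact integrable_boxSum (hψ.integrable_norm_laplace_apply_sq ha hε) L₁ L₂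

theorem IsEvolution.integral_boxNormSq_laplace (ha : IsJacobiData a)
    (hψ : IsEvolution (jacobiOperator a b) ψ₀ ψ) (hT : 0 < T) (hL₁ : 0 ≤ L₁) (hL₂ : 0 ≤ L₂) :
    ∫ E : ℝ, boxNormSq ⇑(laplace ψ (E + (T⁻¹ : ℝ) * Complex.I)) L₁ L₂
      = Real.pi * T * timeAverage T (fun t => boxNormSq (ψ t) L₁ L₂) := by
  have hε : 0 < T⁻¹ := inv_pos.2 hT
  have hplancherel : (fun n => ∫ E : ℝ, ‖laplace ψ (E + (T⁻¹ : ℝ) * Complex.I) n‖ ^ 2)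
      = (2 * Real.pi) • fun n : ℤ =>
        ∫ t in Set.Ioi (0 : ℝ), Real.exp (-2 * T⁻¹ * t) * ‖ψ t n‖ ^ 2 :=
    funext (hψ.integral_norm_laplace_apply_sq ha hε)
  rw [hψ.timeAverage_boxNormSq ha hT hL₁ hL₂]
  simp only [boxNormSq_eq_boxSum _ hL₁ hL₂]
  rw [integral_boxSum (hψ.integrable_norm_laplace_apply_sq ha hε), hplancherel, map_smul,
    smul_eq_mul]
  field_simp

theorem IsEvolution.measureReal_ball_le (ha : IsJacobiData a)
    (hψ : IsEvolution (jacobiOperator a b) delta1 ψ) {μ : Measure ℝ}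
    (hμ : IsSpectralMeasure (jacobiOperator a b) delta1 μ) (hε : 0 < ε) (hL₁ : 0 ≤ L₁)
    (hL₂ : 0 ≤ L₂) {E E' : ℝ} (hE : dist E E' < ε) (hleft : ε⁻¹ ≤ √(leftGram a b E' (L₁ + 1)))
    (hright : ε⁻¹ ≤ √(rightGram a b E' L₂)) :
    μ.real (Metric.ball E ε)
      ≤ 15 * ε ^ 2 * boxNormSq ⇑(laplace ψ (E + ε * Complex.I)) L₁ L₂ := by
  have := hμ.1
  set z : ℂ := E + ε * Complex.I with hz
  have hzim : 0 < z.im := by simpa [hz] using hε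
  have hdist : ‖z - E'‖ ^ 2 ≤ 2 * ε ^ 2 := by
    rw [Real.dist_eq, ← abs_of_pos hε] at hE
    have hsq := sq_lt_sq.2 hE
    have hre : z - E' = (E - E' : ℝ) + ε * Complex.I := by push_cast; ring
    rw [hre, ← Complex.normSq_eq_norm_sq, Complex.normSq_add_mul_I]
    linarith
  have him : (2 * ε)⁻¹ * μ.real (Metric.ball E ε) ≤ |(laplace ψ z 1).im| := by
    rw [← inner_delta1_left, hψ.inner_laplace ha hμ hzim]
    exact (measureReal_ball_le_borelTransform_im μ E hε).trans (le_abs_self _)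
  calc μ.real (Metric.ball E ε)
      = 15 * ε ^ 2 * (2 / 15 * ε⁻¹ * ((2 * ε)⁻¹ * μ.real (Metric.ball E ε))) := by field_simp
    _ ≤ 15 * ε ^ 2 * (2 / 15 * ε⁻¹ * |(laplace ψ z 1).im|) := by gcongr
    _ ≤ 15 * ε ^ 2 * boxNormSq ⇑(laplace ψ z) L₁ L₂ := by
        gcongr
        exact mul_abs_im_le_boxNormSq ha.ne_zero (hψ.jacobiExpr_laplace ha hzim) hε hdist hL₁ hL₂
          hleft hright

theorem IsEvolution.mul_measureReal_lt_timeAverage (ha : IsJacobiData a)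
    (hψ : IsEvolution (jacobiOperator a b) delta1 ψ) {μ : Measure ℝ}
    (hμ : IsSpectralMeasure (jacobiOperator a b) delta1 μ) (hT : 0 < T) (hL₁ : 0 ≤ L₁)
    (hL₂ : 1 ≤ L₂) {S : Set ℝ}
    (hS : ∀ E ∈ S, T⁻¹⁻¹ ≤ √(leftGram a b E (L₁ + 1)) ∧ T⁻¹⁻¹ ≤ √(rightGram a b E L₂)) :
    (15 * Real.pi)⁻¹ * μ.real S < timeAverage T (fun t => boxNormSq (ψ t) L₁ L₂) := by
  have := hμ.1
  have hε : 0 < T⁻¹ := inv_pos.2 hT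
  have hL₂' : 0 ≤ L₂ := zero_le_one.trans hL₂
  set A := timeAverage T fun t => boxNormSq (ψ t) L₁ L₂
  have hA : 0 < A := hψ.timeAverage_boxNormSq_pos ha (by simp [delta1_apply]) hT hL₁ hL₂
  have hle : 2 * T⁻¹ * μ.real S
      ≤ ∫ E : ℝ, 15 * T⁻¹ ^ 2 * boxNormSq ⇑(laplace ψ (E + (T⁻¹ : ℝ) * Complex.I)) L₁ L₂ := by
    refine mul_measureReal_le_integral (by positivity) (fun E => (Real.volume_ball E _).ge)
      ((hψ.integrable_boxNormSq_laplace ha hε hL₁ hL₂').const_mul _)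
      (fun E => mul_nonneg (by positivity) (boxNormSq_nonneg _ hL₁ hL₂')) fun E hE => ?_
    obtain ⟨E', hE', hdist⟩ := Metric.mem_thickening_iff.1 hE
    exact hψ.measureReal_ball_le ha hμ hε hL₁ hL₂' hdist (hS E' hE').1 (hS E' hE').2
  rw [integral_const_mul, hψ.integral_boxNormSq_laplace ha hT hL₁ hL₂'] at hle
  calc (15 * Real.pi)⁻¹ * μ.real S
      = (15 * Real.pi)⁻¹ * (T / 2) * (2 * T⁻¹ * μ.real S) := by field_simp
    _ ≤ (15 * Real.pi)⁻¹ * (T / 2) * (15 * T⁻¹ ^ 2 * (Real.pi * T * A)) := by gcongr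
    _ = A / 2 := by field_simp
    _ < A := half_lt_self hA

end Average

end JacobiDyn

end

theorem theorem1p5 :
    ∃ C : ℝ, 0 < C ∧
      ∀ (a b : ℤ → ℝ), JacobiDyn.IsJacobiData a →
      ∀ (ψ : ℝ → lp (fun _ : ℤ => ℂ) 2),
        JacobiDyn.IsEvolution (JacobiDyn.jacobiOperator a b) JacobiDyn.delta1 ψ →
      ∀ (μ : MeasureTheory.Measure ℝ),
        JacobiDyn.IsSpectralMeasure (JacobiDyn.jacobiOperator a b) JacobiDyn.delta1 μ →
      ∀ (T L₁ L₂ : ℝ), 0 < T → 1 < L₁ → 1 < L₂ →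
        (C * μ.real {E : ℝ | JacobiDyn.scaleLeft a b T⁻¹ E ≤ L₁ ∧
              JacobiDyn.scaleRight a b T⁻¹ E ≤ L₂}
            < JacobiDyn.timeAverage T (fun t => JacobiDyn.boxNormSq (ψ t) L₁ L₂)) ∧
        (2 < L₁ → 2 < L₂ →
          C * μ.real {E : ℝ | JacobiDyn.transferScaleLeft a b T⁻¹ E ≤ L₁ ∧
              JacobiDyn.transferScaleRight a b T⁻¹ E ≤ L₂}
            < JacobiDyn.timeAverage T (fun t => JacobiDyn.boxNormSq (ψ t) L₁ L₂)) := by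
  refine ⟨(15 * Real.pi)⁻¹, by positivity, fun a b ha ψ hψ μ hμ T L₁ L₂ hT hL₁ hL₂ => ?_⟩
  have hε : 0 < T⁻¹ := inv_pos.2 hT
  have hL₁' : 0 ≤ L₁ := (zero_lt_one.trans hL₁).le
  refine ⟨?_, fun _ hL₂_two => ?_⟩
  · exact hψ.mul_measureReal_lt_timeAverage ha hμ hT hL₁' hL₂.le fun E hE =>
      ⟨JacobiDyn.inv_le_sqrt_leftGram ha b hε hE.1, JacobiDyn.inv_le_sqrt_rightGram ha b hε hE.2⟩
  · exact hψ.mul_measureReal_lt_timeAverage ha hμ hT hL₁' hL₂.le fun E hE =>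
      ⟨JacobiDyn.inv_le_sqrt_leftGram_of_transferScaleLeft_le ha b hε hE.1 hL₁.le,
        JacobiDyn.inv_le_sqrt_rightGram_of_transferScaleRight_le ha b hε hE.2 hL₂_two.le⟩
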